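/- Write $o$ for the origin of the Euclidean plane $\mathbb{R}^2$ and $|\cdot|$ for area. A planar convex body is a compact convex set $K\subset\mathbb{R}^2$ with non-empty interior; if $o\in\operatorname{int}K$, its polar body is $K^*=\{x\in\mathbb{R}^2 : \langle x,y\rangle\le 1 \text{ for all } y\in K\}$. Polygons are closed regions and their sides are closed segments. Let $n\ge 3$ be an integer and let $K_i$ and $K_o$ be (non-degenerate) regular $n$-gons such that each vertex of $K_i$ lies on a side of $K_o$; if $n=3$, suppose also that each side of $K_o$ contains a vertex of $K_i$. Then $K_i$ and $K_o$ have a common centre $z$. If $K$ is a planar convex body with $o\in\operatorname{int}K$ and $K_i\subset K\subset K_o$, then $$|K|\cdot|K^*|\ \ge\ n^2\sin^2(\pi/n),$$ with equality if and only if $o=z$ and either $K=K_i$ or $K=K_o$. Consequently, every planar convex body $K$ with $o\in\operatorname{int}K$ satisfies $|K|\cdot|K^*|\ge 27/4$ (the Mahler–Meyer bound), and if moreover $K=-K$, then $|K|\cdot|K^*|\ge 8$ (the Mahler–Reisner bound). -/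

import Mathlib

/-- The Euclidean plane. -/
abbrev Plane : Type := EuclideanSpace ℝ (Fin 2)

/-- The polar of a set with respect to the unit circle centred at the origin. -/
def polarSet (K : Set Plane) : Set Plane :=
  {x | ∀ y ∈ K, inner ℝ x y ≤ 1}

/-- The volume product `|K| |K*|`. -/
noncomputable def volumeProduct (K : Set Plane) : ℝ :=
  MeasureTheory.volume.real K * MeasureTheory.volume.real (polarSet K)

/-- A planar convex body (compact and convex) having the origin as an interior point. -/
structure IsConvexBodyAroundOrigin (K : Set Plane) : Prop where
  convex : Convex ℝ K
  isCompact : IsCompact K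
  zero_mem_interior : (0 : Plane) ∈ interior K

/-- The vertices, in counterclockwise order, of the regular `n`-gon with centre `z`, circumradius
`r` and a vertex in direction `θ`; they depend only on the index `k` modulo `n`. -/
noncomputable def regularVertex (n : ℕ) (z : Plane) (r θ : ℝ) (k : ℕ) : Plane :=
  z + r • !₂[Real.cos (θ + 2 * Real.pi * k / n), Real.sin (θ + 2 * Real.pi * k / n)]

/-- The sides of the regular `n`-gon, as closed segments between consecutive vertices. -/
def regularSide (n : ℕ) (z : Plane) (r θ : ℝ) (k : ℕ) : Set Plane :=
  segment ℝ (regularVertex n z r θ k) (regularVertex n z r θ (k + 1))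

/-- The regular `n`-gon (as a closed region): the convex hull of its vertices. -/
def regularPolygon (n : ℕ) (z : Plane) (r θ : ℝ) : Set Plane :=
  convexHull ℝ (Set.range (regularVertex n z r θ))

open MeasureTheory

/-! Let v_k be the vertices of K_i and let y_k be the pole of the side line of K_o through v_k. Then
v_k ∈ K, y_k ∈ K* and ⟨v_k, y_k⟩ = 1, so y_k defines a support line of K at v_k and v_k one of K* at
y_k. Put g_k = v_{k+1} - v_k and f_k = y_{k+1} - y_k. Let q_k ∈ K maximise det(x, g_k), and let w_k
∈ K* be the pole of the support line of K at q_k parallel to g_k. The sectors of K seen from z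
contain the quadrilaterals z v_k q_k v_{k+1}, and those of K* seen from o have at least the signed
areas of o y_k w_k y_{k+1} (`SupportedFan.sum_cross_le`). As the g_k sum to zero, z may be replaced
by o in the first sum of areas. Hence |K| ≥ ∑ S_k and |K*| ≥ ∑ T_k with S_k = det(q_k, g_k)/2 and
T_k = ⟨g_k, f_k⟩ / (2 det(q_k, g_k)). The product S_k T_k = ⟨g_k, f_k⟩/4 depends only on the
polygons and on o, and Cauchy–Schwarz gives |K| |K*| ≥ (∑ √(S_k T_k))².

If s_k is the distance from o to the k-th side line divided by the inradius of K_o, then ⟨g_k, f_k⟩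
= 4 sin²(π/n) (α/s_k + β/s_{k+1}), where α, β ≥ 0, α + β = 1 and ∑ s_k = n
(`inner_sideVec_poleVec`). The bound √(α/s + β/t) ≥ (3 - αs - βt)/2 then sums to n sin(π/n).

Equality forces s_k = 1 for two consecutive k, hence o = z, and makes all S_k equal. If the caps of
K beyond the sides of K_i are degenerate, K = K_i. Otherwise each cap is a triangle with apex q_k.
The support line can then rotate about q_k, and optimality of w_k in K* places q_k on two
consecutive side lines of K_o (`inner_cap_eq_one`), so K = K_o.

The common centre comes from the numbers ⟨z_i - z_o, u_k⟩, u_k being the side normals of K_o: they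
have a common upper bound, attained at one of any two neighbours, which forces them all to vanish
(`eq_zero_of_inner_ray_le`). The Mahler bounds are the cases n = 3 and n = 4, after a linear map
making an extremal inscribed triangle or parallelogram regular. -/

/-- The determinant of two vectors of the plane. -/
def cross (x y : Plane) : ℝ := x 0 * y 1 - x 1 * y 0

/-! ### Inner product and determinant in coordinates. -/

theorem inner_plane (x y : Plane) : inner ℝ x y = x 0 * y 0 + x 1 * y 1 := by
  simp [PiLp.inner_apply, Fin.sum_univ_two, mul_comm]

theorem plane_ext {x y : Plane} (h0 : x 0 = y 0) (h1 : x 1 = y 1) : x = y := by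
  ext i; fin_cases i <;> assumption

theorem cross_self_eq_zero (x : Plane) : cross x x = 0 := by unfold cross; ring

theorem cross_swap (x y : Plane) : cross x y = -cross y x := by unfold cross; ring

theorem cross_add_left (x y z : Plane) : cross (x + y) z = cross x z + cross y z := by
  simp [cross]; ring

theorem cross_add_right (x y z : Plane) : cross x (y + z) = cross x y + cross x z := by
  simp [cross]; ring

theorem cross_sub_left (x y z : Plane) : cross (x - y) z = cross x z - cross y z := by
  simp [cross]; ring

theorem cross_sub_right (x y z : Plane) : cross x (y - z) = cross x y - cross x z := by
  simp [cross]; ring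

theorem cross_smul_left (t : ℝ) (x y : Plane) : cross (t • x) y = t * cross x y := by
  simp [cross]; ring

theorem cross_smul_right (t : ℝ) (x y : Plane) : cross x (t • y) = t * cross x y := by
  simp [cross]; ring

/-- Cramer's rule in the plane. -/
theorem eq_cross_combination {a b : Plane} (h : cross a b ≠ 0) (x : Plane) :
    x = (cross x b / cross a b) • a + (cross a x / cross a b) • b := by
  apply plane_ext <;> simp <;> field_simp <;> simp only [cross] <;> ring

theorem continuous_cross_right (a : Plane) : Continuous fun x => cross a x := by
  unfold cross; fun_prop

theorem continuous_cross_left (a : Plane) : Continuous fun x => cross x a := by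
  unfold cross; fun_prop

/-! ### Areas of triangles and of sectors of a convex set. -/

/-- The open triangle with vertices `0`, `a`, `b` (empty unless positively oriented). -/
def openTriangle (a b : Plane) : Set Plane :=
  {x | 0 < cross a x ∧ 0 < cross x b ∧ cross a x + cross x b < cross a b}

/-- The closed triangle with vertices `0`, `a`, `b`. -/
def closedTriangle (a b : Plane) : Set Plane :=
  {x | 0 ≤ cross a x ∧ 0 ≤ cross x b ∧ cross a x + cross x b ≤ cross a b}

/-- The open angular sector spanned by `a` and `b`. -/
def openSector (a b : Plane) : Set Plane := {x | 0 < cross a x ∧ 0 < cross x b}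

theorem volume_unit_openTriangle :
    volume {x : Plane | 0 < x 1 ∧ 0 < x 0 ∧ x 1 + x 0 < 1} = ENNReal.ofReal (1 / 2) := by
  have hmp : MeasurePreserving (fun x : Plane => (x 0, x 1)) volume volume :=
    (volume_preserving_finTwoArrow ℝ).comp (PiLp.volume_preserving_ofLp (Fin 2))
  have hs : MeasurableSet (regionBetween (fun _ : ℝ => (0 : ℝ)) (fun t => 1 - t) (Set.Ioo 0 1)) :=
    measurableSet_regionBetween measurable_const (by fun_prop) measurableSet_Ioo
  have hpre : {x : Plane | 0 < x 1 ∧ 0 < x 0 ∧ x 1 + x 0 < 1} = (fun x : Plane => (x 0, x 1)) ⁻¹'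
      (regionBetween (fun _ : ℝ => (0 : ℝ)) (fun t => 1 - t) (Set.Ioo 0 1)) := by
    ext x
    simp only [regionBetween, Set.mem_ofPred_eq, Set.mem_preimage, Set.mem_Ioo]
    constructor
    · rintro ⟨h1, h2, h3⟩; refine ⟨⟨?_, ?_⟩, ?_, ?_⟩ <;> linarith
    · rintro ⟨⟨h1, h2⟩, h3, h4⟩; refine ⟨?_, ?_, ?_⟩ <;> linarith
  rw [hpre, hmp.measure_preimage hs.nullMeasurableSet,
    Measure.volume_eq_prod,
    volume_regionBetween_eq_integral (by simp) ?_ measurableSet_Ioo ?_]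
  · congr 1
    rw [← integral_Ioc_eq_integral_Ioo, ← intervalIntegral.integral_of_le zero_le_one]
    simp only [Pi.sub_apply, sub_zero]
    rw [intervalIntegral.integral_sub (by simp) (by simp)]
    simp; norm_num
  · exact ((continuous_const.sub continuous_id).integrableOn_Icc (a := 0) (b := 1)).mono_set
      Set.Ioo_subset_Icc_self
  · intro x hx; simp only [Set.mem_Ioo] at hx; linarith

/-- The triangle is the image of the standard one under the map with columns `a`, `b`. No
orientation hypothesis is needed, since `ENNReal.ofReal` truncates exactly when the triangle is
empty. -/
theorem volume_openTriangle (a b : Plane) :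
    volume (openTriangle a b) = ENNReal.ofReal (cross a b / 2) := by
  rcases le_or_gt (cross a b) 0 with h | h
  · have : openTriangle a b = ∅ := by
      ext x; simp only [openTriangle, Set.mem_ofPred_eq, Set.mem_empty_iff_false, iff_false]
      rintro ⟨h1, h2, h3⟩; linarith
    rw [this, measure_empty, ENNReal.ofReal_of_nonpos (by linarith)]
  · let M : Matrix (Fin 2) (Fin 2) ℝ := !![a 0, b 0; a 1, b 1]
    let f : Plane →ₗ[ℝ] Plane := Matrix.toLin (EuclideanSpace.basisFun (Fin 2) ℝ).toBasis
      (EuclideanSpace.basisFun (Fin 2) ℝ).toBasis M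
    have hdet : LinearMap.det f = cross a b := by
      simp only [f, LinearMap.det_toLin, M, Matrix.det_fin_two_of, cross]; ring
    have hf : ∀ x, f x = x 0 • a + x 1 • b := by
      intro x
      apply plane_ext <;>
        simp [f, Matrix.toLin_apply, M, Matrix.mulVec, Fin.sum_univ_two, dotProduct] <;> ring
    have himg : openTriangle a b = f '' {x : Plane | 0 < x 1 ∧ 0 < x 0 ∧ x 1 + x 0 < 1} := by
      ext x
      simp only [openTriangle, Set.mem_ofPred_eq, Set.mem_image]
      constructor
      · rintro ⟨h1, h2, h3⟩
        refine ⟨!₂[cross x b / cross a b, cross a x / cross a b], ⟨?_, ?_, ?_⟩, ?_⟩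
        · simpa using div_pos h1 h
        · simpa using div_pos h2 h
        · simp only [Matrix.cons_val_one, Matrix.cons_val_zero]
          rw [← add_div, div_lt_one h]; simpa using h3
        · rw [hf]; simpa using (eq_cross_combination h.ne' x).symm
      · rintro ⟨y, ⟨h1, h2, h3⟩, rfl⟩
        have e1 : cross a (f y) = y 1 * cross a b := by
          rw [hf, cross_add_right, cross_smul_right, cross_smul_right, cross_self_eq_zero]; ring
        have e2 : cross (f y) b = y 0 * cross a b := by
          rw [hf, cross_add_left, cross_smul_left, cross_smul_left, cross_self_eq_zero]; ring
        rw [e1, e2]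
        refine ⟨by positivity, by positivity, ?_⟩
        nlinarith
    rw [himg, Measure.addHaar_image_linearMap, hdet, volume_unit_openTriangle,
      ← ENNReal.ofReal_mul (abs_nonneg _), abs_of_pos h]
    congr 1; ring

theorem convex_openTriangle (a b : Plane) : Convex ℝ (openTriangle a b) := by
  intro x hx y hy s t hs ht hst
  simp only [openTriangle, Set.mem_ofPred_eq, cross_add_left, cross_add_right, cross_smul_left,
    cross_smul_right] at hx hy ⊢
  obtain ⟨h1, h2, h3⟩ := hx
  obtain ⟨h4, h5, h6⟩ := hy
  rcases hs.eq_or_lt with rfl | hs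
  · obtain rfl : t = 1 := by linarith
    simpa using ⟨h4, h5, h6⟩
  · have hab : cross a b = s * cross a b + t * cross a b := by rw [← add_mul, hst, one_mul]
    refine ⟨by positivity, by positivity, ?_⟩
    nlinarith [mul_lt_mul_of_pos_left h3 hs, mul_le_mul_of_nonneg_left h6.le ht]

/-- Sliding a point towards the centroid shows that the closed triangle lies in the closure of the
open one, and the frontier of a convex set is null. -/
theorem volume_closedTriangle_le {a b : Plane} (h : 0 < cross a b) :
    volume (closedTriangle a b) ≤ ENNReal.ofReal (cross a b / 2) := by
  have hsub : closedTriangle a b ⊆ closure (openTriangle a b) := by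
    rintro x ⟨h1, h2, h3⟩
    let g : Plane := (1 / 3 : ℝ) • (a + b)
    have hlim : Filter.Tendsto (fun τ : ℝ => x + τ • (g - x)) (nhdsWithin 0 (Set.Ioi 0))
        (nhds x) := by
      have hc : Continuous fun τ : ℝ => x + τ • (g - x) := by fun_prop
      have := hc.tendsto 0
      simp only [zero_smul, add_zero] at this
      exact this.mono_left nhdsWithin_le_nhds
    refine mem_closure_of_tendsto hlim ?_
    filter_upwards [Ioo_mem_nhdsGT (zero_lt_one' ℝ)] with τ hτ
    obtain ⟨hτ0, hτ1⟩ := hτ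
    have e1 : cross a (x + τ • (g - x)) = (1 - τ) * cross a x + τ * (cross a b / 3) := by
      simp only [g, cross_add_right, cross_smul_right, cross_sub_right, cross_self_eq_zero]; ring
    have e2 : cross (x + τ • (g - x)) b = (1 - τ) * cross x b + τ * (cross a b / 3) := by
      simp only [g, cross_add_left, cross_smul_left, cross_sub_left, cross_self_eq_zero]; ring
    simp only [openTriangle, Set.mem_ofPred_eq, e1, e2]
    have h1τ : 0 < 1 - τ := by linarith
    refine ⟨by positivity, by positivity, ?_⟩
    nlinarith [mul_le_mul_of_nonneg_left h3 h1τ.le, mul_pos hτ0 h]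
  calc volume (closedTriangle a b) ≤ volume (closure (openTriangle a b)) := measure_mono hsub
    _ ≤ volume (openTriangle a b) + volume (frontier (openTriangle a b)) := by
        rw [closure_eq_self_union_frontier]; exact measure_union_le _ _
    _ = ENNReal.ofReal (cross a b / 2) := by
        rw [(convex_openTriangle a b).addHaar_frontier volume, add_zero, volume_openTriangle]

theorem isOpen_openSector (a b : Plane) : IsOpen (openSector a b) :=
  (isOpen_lt continuous_const (continuous_cross_right a)).inter
    (isOpen_lt continuous_const (continuous_cross_left b))

theorem openSector_smul {s t : ℝ} (hs : 0 < s) (ht : 0 < t) (a b : Plane) :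
    openSector (s • a) (t • b) = openSector a b := by
  ext x; simp [openSector, cross_smul_left, cross_smul_right, mul_pos_iff_of_pos_left, hs, ht]

/-- The Plücker relation for four vectors of the plane. -/
theorem cross_plucker (a x c b : Plane) :
    cross a x * cross c b - cross a c * cross x b + cross a b * cross x c = 0 := by
  unfold cross; ring

theorem openTriangle_subset {C : Set Plane} (hC : Convex ℝ C) (h0 : (0 : Plane) ∈ C)
    {a b : Plane} (ha : a ∈ C) (hb : b ∈ C) : openTriangle a b ⊆ C ∩ openSector a b := by
  rintro x ⟨h1, h2, h3⟩
  have h : 0 < cross a b := by linarith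
  refine ⟨?_, h1, h2⟩
  have key := hC.sum_mem (t := Finset.univ) (w := ![cross x b / cross a b,
    cross a x / cross a b, 1 - cross x b / cross a b - cross a x / cross a b]) (z := ![a, b, 0])
    (by
      intro i _
      fin_cases i
      · exact (div_pos h2 h).le
      · exact (div_pos h1 h).le
      · have : cross x b / cross a b + cross a x / cross a b < 1 := by
          rw [← add_div, div_lt_one h]; linarith
        simp; linarith)
    (by simp [Fin.sum_univ_three]) (by intro i _; fin_cases i <;> simpa)
  simp only [Fin.sum_univ_three, Matrix.cons_val, smul_zero, add_zero] at key
  rwa [← eq_cross_combination h.ne' x] at key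

theorem le_measureReal_inter_openSector {C : Set Plane} (hC : Convex ℝ C) (hv : volume C ≠ ⊤)
    (h0 : (0 : Plane) ∈ C) {a b : Plane} (ha : a ∈ C) (hb : b ∈ C) :
    cross a b / 2 ≤ volume.real (C ∩ openSector a b) := by
  have hle := measure_mono (μ := volume) (openTriangle_subset hC h0 ha hb)
  rw [volume_openTriangle] at hle
  exact (ENNReal.ofReal_le_iff_le_toReal
    (measure_ne_top_of_subset Set.inter_subset_left hv)).1 hle

/-- In the Plücker relation for `a`, `x`, `c`, `b`, a point of a subsector outside the large sector
would make all terms nonnegative and one of them positive. The subsectors are separated by the sign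
of `cross x c`. -/
theorem measureReal_openSector_superadditive {C : Set Plane} (hv : volume C ≠ ⊤)
    (hm : MeasurableSet C) {a b c : Plane}
    (hab : 0 < cross a b) (hac : 0 ≤ cross a c) (hcb : 0 ≤ cross c b) :
    volume.real (C ∩ openSector a c) + volume.real (C ∩ openSector c b) ≤
      volume.real (C ∩ openSector a b) := by
  rw [← measureReal_union]
  · refine measureReal_mono ?_ (measure_ne_top_of_subset Set.inter_subset_left hv)
    rintro x (⟨hx, h1, h2⟩ | ⟨hx, h1, h2⟩)
    · refine ⟨hx, h1, ?_⟩
      by_contra hneg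
      nlinarith [cross_plucker a x c b, mul_pos hab h2, mul_nonneg h1.le hcb,
        mul_nonneg hac (neg_nonneg.2 (not_lt.1 hneg))]
    · refine ⟨hx, ?_, h2⟩
      by_contra hneg
      nlinarith [cross_plucker a x c b, mul_pos hab h1, mul_nonneg hac h2.le,
        mul_nonneg hcb (neg_nonneg.2 (not_lt.1 hneg)), cross_swap x c]
  · refine Set.disjoint_left.2 ?_
    rintro x ⟨_, _, h2⟩ ⟨_, h3, _⟩
    have := cross_swap x c
    linarith
  · exact hm.inter (isOpen_openSector _ _).measurableSet

/-! ### The cap of a convex set beyond a chord. -/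

/-- A point of `C` beyond the chord `ab` lies in the cone spanned by `a` and `b` if `a` and `b` lie
on support lines of `C`. -/
theorem cross_nonneg_of_beyond {C : Set Plane} {a b c l m : Plane} (hab : 0 < cross a b)
    (ha : a ∈ C) (hb : b ∈ C) (hc : c ∈ C)
    (hla : inner ℝ l a = 1) (hl : ∀ x ∈ C, inner ℝ l x ≤ 1)
    (hmb : inner ℝ m b = 1) (hm : ∀ x ∈ C, inner ℝ m x ≤ 1)
    (hbe : cross a b < cross c (b - a)) : 0 ≤ cross a c ∧ 0 ≤ cross c b := by
  have hcc := eq_cross_combination hab.ne' c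
  set p := cross c b / cross a b with hp
  set q := cross a c / cross a b with hq
  have hpe : cross c b = p * cross a b := by rw [hp]; field_simp
  have hqe : cross a c = q * cross a b := by rw [hq]; field_simp
  have hpq : 1 < p + q := by
    rw [cross_sub_right, cross_swap c a, hpe, hqe] at hbe
    by_contra hcon
    nlinarith
  have h1 := hl c hc
  have h2 := hm c hc
  have h3 := hl b hb
  have h4 := hm a ha
  rw [hcc, inner_add_right, inner_smul_right, inner_smul_right] at h1 h2
  rw [hla] at h1
  rw [hmb] at h2
  -- If `p < 0`, then ⟨m, a⟩ ≤ 1 gives p⟨m, a⟩ ≥ p, hence p + q ≤ ⟨m, c⟩ ≤ 1, contrary to `hpq`.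
  have hp0 : 0 ≤ p := by
    by_contra hcon
    nlinarith [mul_nonneg (neg_nonneg.2 (not_le.1 hcon).le) (sub_nonneg.2 h4)]
  have hq0 : 0 ≤ q := by
    by_contra hcon
    nlinarith [mul_nonneg (neg_nonneg.2 (not_le.1 hcon).le) (sub_nonneg.2 h3)]
  rw [hpe, hqe]
  exact ⟨by positivity, by positivity⟩

/-- The left side is the signed area of the quadrilateral `0acb`. If `c` is not beyond the chord,
the triangle `0ab` is already large enough; otherwise the support lines keep `c` in the cone and the
triangles `0ac` and `0cb` fit side by side. -/
theorem cross_le_measureReal_sector {C : Set Plane} (hC : Convex ℝ C) (hv : volume C ≠ ⊤)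
    (hmeas : MeasurableSet C)
    (h0 : (0 : Plane) ∈ C) {a b c l m : Plane} (hab : 0 < cross a b)
    (ha : a ∈ C) (hb : b ∈ C) (hc : c ∈ C)
    (hla : inner ℝ l a = 1) (hl : ∀ x ∈ C, inner ℝ l x ≤ 1)
    (hmb : inner ℝ m b = 1) (hm : ∀ x ∈ C, inner ℝ m x ≤ 1) :
    cross c (b - a) / 2 ≤ volume.real (C ∩ openSector a b) := by
  rcases le_or_gt (cross c (b - a)) (cross a b) with h | h
  · exact (div_le_div_of_nonneg_right h two_pos.le).trans
      (le_measureReal_inter_openSector hC hv h0 ha hb)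
  · obtain ⟨h1, h2⟩ := cross_nonneg_of_beyond hab ha hb hc hla hl hmb hm h
    have h3 := measureReal_openSector_superadditive hv hmeas hab h1 h2
    have h4 := le_measureReal_inter_openSector hC hv h0 ha hc
    have h5 := le_measureReal_inter_openSector hC hv h0 hc hb
    rw [cross_sub_right, cross_swap c a]
    linarith

/-- `d` is a convex combination of `a`, `c`, `b`. -/
def InTriangle (a c b d : Plane) : Prop :=
  ∃ α β γ : ℝ, 0 ≤ α ∧ 0 ≤ β ∧ 0 ≤ γ ∧ α + β + γ = 1 ∧ d = α • a + β • c + γ • b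

theorem inTriangle_symm {a b c d : Plane} (h : InTriangle a c b d) : InTriangle b c a d := by
  obtain ⟨α, β, γ, h1, h2, h3, h4, rfl⟩ := h
  exact ⟨γ, β, α, h3, h2, h1, by linarith, by abel⟩

/-- By `hpos` the point `d` is on the `b` side of the ray through `c`, and `harea` says that it is
in the triangle `0cb`. The hypothesis `hcone` excludes a `c` on the ray of `b` strictly beyond the
chord. -/
theorem inTriangle_of_coordinates {a b c d : Plane} {c1 c2 d1 d2 : ℝ}
    (hc : c = c1 • a + c2 • b) (hd : d = d1 • a + d2 • b) (hc1 : 0 ≤ c1) (hc2 : 0 ≤ c2)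
    (hd1 : 0 ≤ d1) (hd2 : 0 ≤ d2) (hcge : 1 ≤ c1 + c2) (hdge : 1 ≤ d1 + d2)
    (hdle : d1 + d2 ≤ c1 + c2) (hcone : c1 = 0 → c1 + c2 = 1) (hpos : 0 ≤ c1 * d2 - c2 * d1)
    (harea : c1 * d2 - c2 * d1 + d1 ≤ c1) : InTriangle a c b d := by
  rcases hcge.eq_or_lt with h1 | h1
  · exact ⟨d1, 0, d2, hd1, le_rfl, hd2, by linarith, by simp [hd]⟩
  · have hc1' : 0 < c1 := lt_of_le_of_ne hc1 fun h => by have := hcone h.symm; linarith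
    have hw : 0 < c1 + c2 - 1 := by linarith
    -- Ratio of the heights of `d` and `c` above the chord, which is the barycentric weight of `c`.
    -- Writing d = p c + q b with p + q ≤ 1, the excess (p - β) c is redistributed over `a` and `b`;
    -- `hβp` makes it nonnegative.
    set β := (d1 + d2 - 1) / (c1 + c2 - 1) with hβ
    have hβe : β * (c1 + c2 - 1) = d1 + d2 - 1 := by rw [hβ]; field_simp
    set p := d1 / c1 with hp
    have hpe : p * c1 = d1 := by rw [hp]; field_simp
    have hp0 : 0 ≤ p := by positivity
    have hq0 : 0 ≤ d2 - p * c2 := by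
      have : 0 ≤ c1 * (d2 - p * c2) := by rw [← hpe] at hpos; linarith
      exact nonneg_of_mul_nonneg_right this hc1'
    have hpq : p + (d2 - p * c2) ≤ 1 := by
      have : c1 * (p + (d2 - p * c2)) ≤ c1 * 1 := by rw [← hpe] at harea; linarith
      exact le_of_mul_le_mul_left this hc1'
    have hβp : β ≤ p := by
      have : β * (c1 + c2 - 1) ≤ p * (c1 + c2 - 1) := by rw [hβe]; linarith
      exact le_of_mul_le_mul_right this hw
    have hβ0 : 0 ≤ β := div_nonneg (by linarith) hw.le
    refine ⟨(p - β) * c1, β, (p - β) * c2 + (d2 - p * c2),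
      mul_nonneg (by linarith) hc1, hβ0, by
        have := mul_nonneg (sub_nonneg.2 hβp) hc2; linarith, by linarith, ?_⟩
    have e1 : d1 = (p - β) * c1 + β * c1 := by linarith
    have e2 : d2 = β * c2 + ((p - β) * c2 + (d2 - p * c2)) := by ring
    rw [hd, hc]
    conv_lhs => rw [e1, e2]
    module

/-- If the sector of `C` between `a` and `b` is exhausted by the triangles `0ac` and `0cb`, then the
part of `C` beyond the chord `ab` is the triangle `acb`. -/
theorem inTriangle_of_measureReal_sector_le {C : Set Plane} (hC : Convex ℝ C)
    (hv : volume C ≠ ⊤) (hmeas : MeasurableSet C)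
    (h0 : (0 : Plane) ∈ C) {a b c d l m : Plane} (hab : 0 < cross a b)
    (ha : a ∈ C) (hb : b ∈ C) (hc : c ∈ C) (hd : d ∈ C)
    (hla : inner ℝ l a = 1) (hl : ∀ x ∈ C, inner ℝ l x ≤ 1)
    (hmb : inner ℝ m b = 1) (hm : ∀ x ∈ C, inner ℝ m x ≤ 1)
    (hcge : cross a b < cross c (b - a)) (hdge : cross a b < cross d (b - a))
    (hdle : cross d (b - a) ≤ cross c (b - a))
    (hvol : volume.real (C ∩ openSector a b) ≤ cross c (b - a) / 2) : InTriangle a c b d := by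
  obtain ⟨hac, hcb⟩ := cross_nonneg_of_beyond hab ha hb hc hla hl hmb hm hcge
  obtain ⟨had, hdb⟩ := cross_nonneg_of_beyond hab ha hb hd hla hl hmb hm hdge
  have hcc := eq_cross_combination hab.ne' c
  have hdd := eq_cross_combination hab.ne' d
  have hlc := hl c hc
  have hmc := hm c hc
  have hmd := hm d hd
  rw [hcc, inner_add_right, inner_smul_right, inner_smul_right] at hlc hmc
  rw [hla] at hlc
  rw [hmb] at hmc
  set c1 := cross c b / cross a b with hc1
  set c2 := cross a c / cross a b with hc2
  set d1 := cross d b / cross a b with hd1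
  set d2 := cross a d / cross a b with hd2
  have ec1 : cross c b = c1 * cross a b := by rw [hc1]; field_simp
  have ec2 : cross a c = c2 * cross a b := by rw [hc2]; field_simp
  have ed1 : cross d b = d1 * cross a b := by rw [hd1]; field_simp
  have ed2 : cross a d = d2 * cross a b := by rw [hd2]; field_simp
  have ecd : cross c d = (c1 * d2 - c2 * d1) * cross a b := by
    conv_lhs => rw [hcc, hdd]
    simp only [cross_add_left, cross_add_right, cross_smul_left, cross_smul_right, cross_self_eq_zero]
    rw [cross_swap b a]; ring
  have hc10 : 0 ≤ c1 := div_nonneg hcb hab.le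
  have hc20 : 0 ≤ c2 := div_nonneg hac hab.le
  have hd10 : 0 ≤ d1 := div_nonneg hdb hab.le
  have hd20 : 0 ≤ d2 := div_nonneg had hab.le
  rw [cross_sub_right, cross_swap c a, ec1, ec2] at hcge hvol
  rw [cross_sub_right, cross_swap d a, ed1, ed2] at hdge
  rw [cross_sub_right, cross_sub_right, cross_swap c a, cross_swap d a, ec1, ec2, ed1, ed2] at hdle
  have hcge' : 1 ≤ c1 + c2 := by
    refine le_of_mul_le_mul_right ?_ hab; linarith
  have hdge' : 1 ≤ d1 + d2 := by
    refine le_of_mul_le_mul_right ?_ hab; linarith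
  have hdle' : d1 + d2 ≤ c1 + c2 := by
    refine le_of_mul_le_mul_right ?_ hab; linarith
  have hz1 : c1 = 0 → c1 + c2 = 1 := by
    intro h; rw [h] at hmc hcge' ⊢; linarith
  have hz2 : c2 = 0 → c1 + c2 = 1 := by
    intro h; rw [h] at hlc hcge' ⊢; linarith
  -- Depending on the side of the ray `0c` on which `d` lies, the disjoint triangles `0ac`, `0cd`,
  -- `0db` or `0ad`, `0dc`, `0cb` fit in the sector. Comparison with the area of `0acb` puts `d` in
  -- the triangle `0cb` or `0ac`.
  rcases le_total 0 (c1 * d2 - c2 * d1) with hs | hs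
  · refine inTriangle_of_coordinates hcc hdd hc10 hc20 hd10 hd20 hcge' hdge' hdle' hz1 hs ?_
    rcases hc10.eq_or_lt with hc1z | hc1p
    · have : c2 = 1 := by have := hz1 hc1z.symm; linarith
      rw [← hc1z, this]; linarith
    · have hcbp : 0 < cross c b := by rw [ec1]; positivity
      have hcd : 0 ≤ cross c d := by rw [ecd]; positivity
      have s1 := measureReal_openSector_superadditive hv hmeas hab hac hcb
      have s2 := measureReal_openSector_superadditive hv hmeas hcbp hcd hdb
      have s3 := le_measureReal_inter_openSector hC hv h0 ha hc
      have s4 := le_measureReal_inter_openSector hC hv h0 hc hd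
      have s5 := le_measureReal_inter_openSector hC hv h0 hd hb
      rw [ec2] at s3
      rw [ecd] at s4
      rw [ed1] at s5
      refine le_of_mul_le_mul_right ?_ hab
      linarith
  · refine inTriangle_symm (inTriangle_of_coordinates (c1 := c2) (c2 := c1) (d1 := d2) (d2 := d1)
      (by rw [hcc]; abel) (by rw [hdd]; abel) hc20 hc10 hd20 hd10 (by linarith) (by linarith)
      (by linarith) (fun h => by have := hz2 h; linarith) (by linarith) ?_)
    rcases hc20.eq_or_lt with hc2z | hc2p
    · have : c1 = 1 := by have := hz2 hc2z.symm; linarith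
      rw [← hc2z, this]; linarith
    · have hacp : 0 < cross a c := by rw [ec2]; positivity
      have edc : cross d c = (c2 * d1 - c1 * d2) * cross a b := by
        rw [cross_swap, ecd]; ring
      have hdc : 0 ≤ cross d c := by
        rw [edc]; exact mul_nonneg (by linarith) hab.le
      have s1 := measureReal_openSector_superadditive hv hmeas hab hac hcb
      have s2 := measureReal_openSector_superadditive hv hmeas hacp had hdc
      have s3 := le_measureReal_inter_openSector hC hv h0 ha hd
      have s4 := le_measureReal_inter_openSector hC hv h0 hd hc
      have s5 := le_measureReal_inter_openSector hC hv h0 hc hb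
      rw [ed2] at s3
      rw [edc] at s4
      rw [ec1] at s5
      refine le_of_mul_le_mul_right ?_ hab
      linarith

/-! ### Equally spaced directions and the sectors between them. -/

/-- The unit vector at angle `t`. -/
noncomputable def dir (t : ℝ) : Plane := !₂[Real.cos t, Real.sin t]

/-- The `k`-th of `n` equally spaced unit vectors, starting at angle `A`. -/
noncomputable def ray (n : ℕ) (A : ℝ) (k : ℕ) : Plane := dir (A + 2 * Real.pi * k / n)

theorem inner_dir_dir (s t : ℝ) : inner ℝ (dir s) (dir t) = Real.cos (s - t) := by
  rw [inner_plane, Real.cos_sub]; rfl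

theorem cross_dir_dir (s t : ℝ) : cross (dir s) (dir t) = Real.sin (t - s) := by
  rw [Real.sin_sub]; simp only [cross, dir, Matrix.cons_val]; ring

theorem dir_add_two_pi (t : ℝ) : dir (t + 2 * Real.pi) = dir t := by
  unfold dir; rw [Real.cos_add_two_pi, Real.sin_add_two_pi]

theorem dir_add_int_mul_two_pi (t : ℝ) (m : ℤ) : dir (t + m * (2 * Real.pi)) = dir t := by
  unfold dir; rw [Real.cos_add_int_mul_two_pi, Real.sin_add_int_mul_two_pi]

theorem regularVertex_eq (n : ℕ) (z : Plane) (r θ : ℝ) (k : ℕ) :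
    regularVertex n z r θ k = z + r • ray n θ k := rfl

theorem ray_succ_eq (n : ℕ) (A : ℝ) (k : ℕ) :
    ray n A (k + 1) = dir (A + 2 * Real.pi * k / n + 2 * Real.pi / n) := by
  unfold ray; congr 1; push_cast; ring

theorem ray_shift (n : ℕ) (A B : ℝ) (k : ℕ) :
    ray n (A + B) k = dir (A + 2 * Real.pi * k / n + B) := by
  unfold ray; congr 1; ring

theorem ray_add_self {n : ℕ} (hn : 3 ≤ n) (A : ℝ) (k : ℕ) : ray n A (k + n) = ray n A k := by
  have hn0 : (n : ℝ) ≠ 0 := by positivity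
  unfold ray
  rw [← dir_add_two_pi (A + 2 * Real.pi * k / n)]; congr 1; push_cast; field_simp; ring

theorem two_pi_div_bounds {n : ℕ} (hn : 3 ≤ n) :
    0 < Real.pi / n ∧ Real.pi / n ≤ Real.pi / 3 ∧ 2 * Real.pi / n = 2 * (Real.pi / n) := by
  have h3 : (3 : ℝ) ≤ n := by exact_mod_cast hn
  refine ⟨by positivity, ?_, by ring⟩
  exact div_le_div_of_nonneg_left Real.pi_pos.le (by norm_num) h3

theorem sin_pi_div_pos {n : ℕ} (hn : 3 ≤ n) : 0 < Real.sin (Real.pi / n) := by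
  obtain ⟨h1, h2, _⟩ := two_pi_div_bounds hn
  exact Real.sin_pos_of_pos_of_lt_pi h1 (by linarith [Real.pi_pos])

theorem cos_pi_div_pos {n : ℕ} (hn : 3 ≤ n) : 0 < Real.cos (Real.pi / n) := by
  obtain ⟨h1, h2, _⟩ := two_pi_div_bounds hn
  exact Real.cos_pos_of_mem_Ioo ⟨by linarith [Real.pi_pos], by linarith [Real.pi_pos]⟩

theorem sin_two_pi_div_pos {n : ℕ} (hn : 3 ≤ n) : 0 < Real.sin (2 * Real.pi / n) := by
  rw [(two_pi_div_bounds hn).2.2, Real.sin_two_mul]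
  have := sin_pi_div_pos hn
  have := cos_pi_div_pos hn
  positivity

theorem cross_ray_ray_succ (n : ℕ) (A : ℝ) (k : ℕ) :
    cross (ray n A k) (ray n A (k + 1)) = Real.sin (2 * Real.pi / n) := by
  rw [ray_succ_eq, ray, cross_dir_dir]; congr 1; ring

/-- A vector is determined by its inner products with two independent vectors. -/
theorem eq_of_inner_eq {u v x y : Plane} (huv : cross u v ≠ 0) (h1 : inner ℝ u x = inner ℝ u y)
    (h2 : inner ℝ v x = inner ℝ v y) : x = y := by
  rw [inner_plane, inner_plane] at h1 h2
  unfold cross at huv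
  apply plane_ext
  · have : (u 0 * v 1 - u 1 * v 0) * (x 0 - y 0) = 0 := by linear_combination v 1 * h1 - u 1 * h2
    rcases mul_eq_zero.1 this with h | h
    · exact absurd h huv
    · linarith
  · have : (u 0 * v 1 - u 1 * v 0) * (x 1 - y 1) = 0 := by linear_combination u 0 * h2 - v 0 * h1
    rcases mul_eq_zero.1 this with h | h
    · exact absurd h huv
    · linarith

/-- Multiplication by 2 sin(π/n) makes the sum telescope over a full turn. -/
theorem sum_cos_equidistributed {n : ℕ} (hn : 3 ≤ n) (A : ℝ) :
    ∑ k ∈ Finset.range n, Real.cos (A + 2 * Real.pi * k / n) = 0 := by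
  have hn0 : (n : ℝ) ≠ 0 := by positivity
  have hs := sin_pi_div_pos hn
  have key : ∀ k : ℕ, Real.cos (A + 2 * Real.pi * k / n) * (2 * Real.sin (Real.pi / n)) =
      Real.sin (A - Real.pi / n + 2 * Real.pi * ((k + 1 : ℕ) : ℝ) / n) -
        Real.sin (A - Real.pi / n + 2 * Real.pi * (k : ℝ) / n) := by
    intro k
    have e1 : A - Real.pi / n + 2 * Real.pi * ((k + 1 : ℕ) : ℝ) / n =
        (A + 2 * Real.pi * k / n) + Real.pi / n := by push_cast; ring
    have e2 : A - Real.pi / n + 2 * Real.pi * (k : ℝ) / n =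
        (A + 2 * Real.pi * k / n) - Real.pi / n := by ring
    rw [e1, e2, Real.sin_add, Real.sin_sub]; ring
  have h : (∑ k ∈ Finset.range n, Real.cos (A + 2 * Real.pi * k / n)) *
      (2 * Real.sin (Real.pi / n)) = 0 := by
    rw [Finset.sum_mul, Finset.sum_congr rfl fun k _ => key k, Finset.sum_range_sub
      (fun k : ℕ => Real.sin (A - Real.pi / n + 2 * Real.pi * (k : ℝ) / n))]
    have e3 : A - Real.pi / n + 2 * Real.pi * (n : ℝ) / n = A - Real.pi / n + 2 * Real.pi := by
      field_simp
    simp only [e3, Real.sin_add_two_pi]; simp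
  rcases mul_eq_zero.1 h with h | h
  · exact h
  · exfalso; linarith

theorem exists_polar (x : Plane) : ∃ R ψ : ℝ, 0 ≤ R ∧ x = R • dir ψ := by
  refine ⟨‖(⟨x 0, x 1⟩ : ℂ)‖, Complex.arg ⟨x 0, x 1⟩, norm_nonneg _, ?_⟩
  apply plane_ext
  · simp [dir, Complex.norm_mul_cos_arg]
  · simp [dir, Complex.norm_mul_sin_arg]

theorem sum_inner_ray {n : ℕ} (hn : 3 ≤ n) (A : ℝ) (d : Plane) :
    ∑ k ∈ Finset.range n, inner ℝ d (ray n A k) = 0 := by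
  obtain ⟨R, ψ, _, rfl⟩ := exists_polar d
  have : ∀ k : ℕ, inner ℝ (R • dir ψ) (ray n A k) =
      R * Real.cos ((A - ψ) + 2 * Real.pi * k / n) := by
    intro k
    rw [inner_smul_left, ray, inner_dir_dir, ← Real.cos_neg]
    simp only [conj_trivial]; congr 2; ring
  rw [Finset.sum_congr rfl fun k _ => this k, ← Finset.mul_sum, sum_cos_equidistributed hn,
    mul_zero]

theorem exists_int_sub_two_pi (t : ℝ) :
    ∃ m : ℤ, 0 ≤ t - m * (2 * Real.pi) ∧ t - m * (2 * Real.pi) < 2 * Real.pi := by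
  refine ⟨⌊t / (2 * Real.pi)⌋, ?_, ?_⟩
  · have := Int.floor_le (t / (2 * Real.pi))
    rw [le_div_iff₀ Real.two_pi_pos] at this; linarith
  · have := Int.lt_floor_add_one (t / (2 * Real.pi))
    rw [div_lt_iff₀ Real.two_pi_pos] at this; linarith

theorem cross_dir_smul (R s t : ℝ) : cross (dir s) (R • dir t) = R * Real.sin (t - s) := by
  rw [cross_smul_right, cross_dir_dir]

theorem cross_smul_dir (R s t : ℝ) : cross (R • dir t) (dir s) = R * Real.sin (s - t) := by
  rw [cross_smul_left, cross_dir_dir]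

/-- Since the opening `N` is less than π, the signs of the two sines determine the angle modulo 2π.
-/
theorem angle_of_mem_openSector {B N R ψ : ℝ} (hR : 0 ≤ R) (hN0 : 0 ≤ N) (hN : N < Real.pi)
    (h : R • dir ψ ∈ openSector (dir B) (dir (B + N))) :
    ∃ m : ℤ, B < ψ - m * (2 * Real.pi) ∧ ψ - m * (2 * Real.pi) < B + N := by
  obtain ⟨h1, h2⟩ := h
  rw [cross_dir_smul] at h1
  rw [cross_smul_dir] at h2
  have s1 := pos_of_mul_pos_right h1 hR
  have s2 := pos_of_mul_pos_right h2 hR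
  obtain ⟨m, hm0, hm1⟩ := exists_int_sub_two_pi (ψ - B)
  set τ := ψ - B - m * (2 * Real.pi) with hτ
  have e1 : Real.sin (ψ - B) = Real.sin τ := by rw [hτ, Real.sin_sub_int_mul_two_pi]
  have e2 : Real.sin (B + N - ψ) = Real.sin (N - τ) := by
    rw [hτ, show N - (ψ - B - m * (2 * Real.pi)) = (B + N - ψ) + m * (2 * Real.pi) by ring,
      Real.sin_add_int_mul_two_pi]
  rw [e1] at s1
  rw [e2] at s2
  have hτ0 : 0 < τ := lt_of_le_of_ne hm0 fun h => by rw [← h, Real.sin_zero] at s1; linarith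
  have hτπ : τ < Real.pi := by
    by_contra hcon
    have := Real.sin_nonpos_of_nonpos_of_neg_pi_le (x := τ - 2 * Real.pi) (by linarith)
      (by linarith)
    rw [Real.sin_sub_two_pi] at this
    linarith
  have hτN : τ < N := by
    by_contra hcon
    have := Real.sin_nonpos_of_nonpos_of_neg_pi_le (x := N - τ) (by linarith) (by linarith)
    linarith
  exact ⟨m, by linarith, by linarith⟩

theorem disjoint_openSector_ray {n : ℕ} (hn : 3 ≤ n) (A : ℝ) {k l : ℕ} (hkl : k < l)
    (hl : l < n) : Disjoint (openSector (ray n A k) (ray n A (k + 1)))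
      (openSector (ray n A l) (ray n A (l + 1))) := by
  rw [Set.disjoint_left]
  intro x hk hl'
  obtain ⟨R, ψ, hR, rfl⟩ := exists_polar x
  obtain ⟨b1, b2, b3⟩ := two_pi_div_bounds hn
  have hpi := Real.pi_pos
  have hn0 : (0 : ℝ) < n := by positivity
  rw [ray_succ_eq, ray] at hk hl'
  obtain ⟨m, hm1, hm2⟩ := angle_of_mem_openSector hR (by positivity) (by linarith) hk
  obtain ⟨m', hm1', hm2'⟩ := angle_of_mem_openSector hR (by positivity) (by linarith) hl'
  set N := 2 * Real.pi / n with hN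
  have hNpos : 0 < N := by positivity
  have e : 2 * Real.pi = n * N := by rw [hN]; field_simp
  have ek : 2 * Real.pi * k / n = k * N := by rw [hN]; ring
  have el : 2 * Real.pi * l / n = l * N := by rw [hN]; ring
  rw [ek] at hm1 hm2
  rw [el] at hm1' hm2'
  rw [e] at hm1 hm2 hm1' hm2'
  have i1 : ((l : ℝ) - k - 1) * N < ((m - m') * n) * N := by linarith
  have i2 : ((m - m') * n : ℝ) * N < ((l : ℝ) - k + 1) * N := by linarith
  have j1 := lt_of_mul_lt_mul_right i1 hNpos.le
  have j2 := lt_of_mul_lt_mul_right i2 hNpos.le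
  have j1' : (l : ℤ) - k - 1 < (m - m') * n := by exact_mod_cast j1
  have j2' : (m - m') * n < (l : ℤ) - k + 1 := by exact_mod_cast j2
  -- Angles in both sectors would make a multiple of n equal to l - k, which lies strictly between 0
  -- and n.
  have j3 : (m - m') * n = (l : ℤ) - k := by omega
  have c1 : 0 < m - m' := by
    by_contra hcon
    have : (m - m') * (n : ℤ) ≤ 0 := mul_nonpos_of_nonpos_of_nonneg (by omega) (by omega)
    omega
  have : (n : ℤ) ≤ (m - m') * n := le_mul_of_one_le_left (by omega) (by omega)
  omega

theorem exists_ray_sector {n : ℕ} (hn : 3 ≤ n) (A : ℝ) (x : Plane) :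
    ∃ k < n, 0 ≤ cross (ray n A k) x ∧ 0 ≤ cross x (ray n A (k + 1)) := by
  obtain ⟨R, ψ, hR, rfl⟩ := exists_polar x
  obtain ⟨b1, b2, b3⟩ := two_pi_div_bounds hn
  have hpi := Real.pi_pos
  have hn0 : (0 : ℝ) < n := by positivity
  obtain ⟨m, hm0, hm1⟩ := exists_int_sub_two_pi (ψ - A)
  set τ := ψ - A - m * (2 * Real.pi) with hτ
  set N := 2 * Real.pi / n with hN
  have hNpos : 0 < N := by positivity
  have e : 2 * Real.pi = n * N := by rw [hN]; field_simp
  have f1 := Nat.floor_le (div_nonneg hm0 hNpos.le)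
  have f2 := Nat.lt_floor_add_one (τ / N)
  rw [le_div_iff₀ hNpos] at f1
  rw [div_lt_iff₀ hNpos] at f2
  refine ⟨⌊τ / N⌋₊, ?_, ?_, ?_⟩
  · rw [e] at hm1
    have : (⌊τ / N⌋₊ : ℝ) < n := lt_of_mul_lt_mul_right (f1.trans_lt hm1) hNpos.le
    exact_mod_cast this
  · rw [ray, cross_dir_smul]
    refine mul_nonneg hR ?_
    rw [show ψ - (A + 2 * Real.pi * ⌊τ / N⌋₊ / n) = (τ - ⌊τ / N⌋₊ * N) + m * (2 * Real.pi) by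
      rw [hτ, hN]; ring, Real.sin_add_int_mul_two_pi]
    exact Real.sin_nonneg_of_nonneg_of_le_pi (by linarith) (by linarith)
  · rw [ray_succ_eq, cross_smul_dir]
    refine mul_nonneg hR ?_
    rw [show (A + 2 * Real.pi * ⌊τ / N⌋₊ / n + 2 * Real.pi / n) - ψ =
      ((⌊τ / N⌋₊ + 1) * N - τ) - m * (2 * Real.pi) by
      rw [hτ, hN]; ring, Real.sin_sub_int_mul_two_pi]
    exact Real.sin_nonneg_of_nonneg_of_le_pi (by linarith) (by linarith)

/-! ### Lower bounds for area by summing caps over a fan. -/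

/-- A closed convex set of finite area around the origin, with points `a k` in `n` equally spaced
directions, each lying on a support line of the set. -/
structure SupportedFan (n : ℕ) (A : ℝ) (C : Set Plane) (a : ℕ → Plane) : Prop where
  convex : Convex ℝ C
  isClosed : IsClosed C
  finite : volume C ≠ ⊤
  zero_mem : (0 : Plane) ∈ C
  mem : ∀ k, a k ∈ C
  direction : ∀ k, ∃ s : ℝ, 0 < s ∧ a k = s • ray n A k
  support : ∀ k, ∃ l : Plane, inner ℝ l (a k) = 1 ∧ ∀ x ∈ C, inner ℝ l x ≤ 1

namespace SupportedFan

variable {n : ℕ} {A : ℝ} {C : Set Plane} {a c : ℕ → Plane}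

theorem cross_pos (h : SupportedFan n A C a) (hn : 3 ≤ n) (k : ℕ) :
    0 < cross (a k) (a (k + 1)) := by
  obtain ⟨s, hs, e1⟩ := h.direction k
  obtain ⟨t, ht, e2⟩ := h.direction (k + 1)
  rw [e1, e2, cross_smul_left, cross_smul_right, cross_ray_ray_succ]
  have := sin_two_pi_div_pos hn
  positivity

theorem sum_sector_le (h : SupportedFan n A C a) (hn : 3 ≤ n) :
    ∑ k ∈ Finset.range n, volume.real (C ∩ openSector (a k) (a (k + 1))) ≤ volume.real C := by
  have hsec : ∀ k, openSector (a k) (a (k + 1)) = openSector (ray n A k) (ray n A (k + 1)) := by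
    intro k
    obtain ⟨s, hs, e1⟩ := h.direction k
    obtain ⟨t, ht, e2⟩ := h.direction (k + 1)
    rw [e1, e2, openSector_smul hs ht]
  rw [← measureReal_biUnion_finset (h := fun k _ =>
    measure_ne_top_of_subset Set.inter_subset_left h.finite)]
  · exact measureReal_mono (Set.iUnion₂_subset fun k _ => Set.inter_subset_left) h.finite
  · intro k hk l hl hkl
    rw [Finset.coe_range, Set.mem_Iio] at hk hl
    refine Disjoint.mono Set.inter_subset_right Set.inter_subset_right ?_
    simp only [hsec]
    rcases lt_or_gt_of_ne hkl with hlt | hlt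
    · exact disjoint_openSector_ray hn A hlt hl
    · exact (disjoint_openSector_ray hn A hlt hk).symm
  · exact fun k _ => h.isClosed.measurableSet.inter (isOpen_openSector _ _).measurableSet

theorem cross_le_sector (h : SupportedFan n A C a) (hn : 3 ≤ n) (k : ℕ) {d : Plane}
    (hd : d ∈ C) : cross d (a (k + 1) - a k) / 2 ≤
      volume.real (C ∩ openSector (a k) (a (k + 1))) := by
  obtain ⟨l, hl1, hl2⟩ := h.support k
  obtain ⟨m, hm1, hm2⟩ := h.support (k + 1)
  exact cross_le_measureReal_sector h.convex h.finite h.isClosed.measurableSet h.zero_mem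
    (h.cross_pos hn k) (h.mem k) (h.mem (k + 1)) hd hl1 hl2 hm1 hm2

/-- The sectors of the fan are disjoint, and each has at least the area of its quadrilateral with
outer vertex `c k`. This is applied both to the translated body and to its polar. -/
theorem sum_cross_le (h : SupportedFan n A C a) (hn : 3 ≤ n)
    (hc : ∀ k ∈ Finset.range n, c k ∈ C) :
    ∑ k ∈ Finset.range n, cross (c k) (a (k + 1) - a k) / 2 ≤ volume.real C :=
  (Finset.sum_le_sum fun k hk => h.cross_le_sector hn k (hc k hk)).trans (h.sum_sector_le hn)

theorem sector_eq_of_eq (h : SupportedFan n A C a) (hn : 3 ≤ n)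
    (hc : ∀ k ∈ Finset.range n, c k ∈ C)
    (heq : ∑ k ∈ Finset.range n, cross (c k) (a (k + 1) - a k) / 2 = volume.real C)
    {k : ℕ} (hk : k ∈ Finset.range n) :
    cross (c k) (a (k + 1) - a k) / 2 = volume.real (C ∩ openSector (a k) (a (k + 1))) := by
  have hle := fun k hk => h.cross_le_sector hn k (hc k hk)
  refine (Finset.sum_eq_sum_iff_of_le hle).1 ?_ k hk
  exact le_antisymm (Finset.sum_le_sum hle) ((h.sum_sector_le hn).trans heq.ge)

/-- Equality of the sums is equality in every sector, and any `d` in `C` gives another lower bound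
for the same sector area. Hence `c k` is extremal in its direction. -/
theorem cross_le_of_eq (h : SupportedFan n A C a) (hn : 3 ≤ n)
    (hc : ∀ k ∈ Finset.range n, c k ∈ C)
    (heq : ∑ k ∈ Finset.range n, cross (c k) (a (k + 1) - a k) / 2 = volume.real C)
    {k : ℕ} (hk : k ∈ Finset.range n) {d : Plane} (hd : d ∈ C) :
    cross d (a (k + 1) - a k) ≤ cross (c k) (a (k + 1) - a k) := by
  have h1 := h.cross_le_sector hn k hd
  rw [← h.sector_eq_of_eq hn hc heq hk] at h1
  linarith

theorem inTriangle_of_eq (h : SupportedFan n A C a) (hn : 3 ≤ n)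
    (hc : ∀ k ∈ Finset.range n, c k ∈ C)
    (heq : ∑ k ∈ Finset.range n, cross (c k) (a (k + 1) - a k) / 2 = volume.real C)
    {k : ℕ} (hk : k ∈ Finset.range n) {d : Plane} (hd : d ∈ C)
    (hdge : cross (a k) (a (k + 1)) < cross d (a (k + 1) - a k)) :
    InTriangle (a k) (c k) (a (k + 1)) d := by
  obtain ⟨l, hl1, hl2⟩ := h.support k
  obtain ⟨m, hm1, hm2⟩ := h.support (k + 1)
  have hdle := h.cross_le_of_eq hn hc heq hk hd
  exact inTriangle_of_measureReal_sector_le h.convex h.finite h.isClosed.measurableSet h.zero_mem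
    (h.cross_pos hn k) (h.mem k) (h.mem (k + 1)) (hc k hk) hd hl1 hl2 hm1 hm2
    (hdge.trans_le hdle) hdge hdle (h.sector_eq_of_eq hn hc heq hk).ge

end SupportedFan

/-! ### Cosines of equally spaced angles. -/

theorem cos_sub_cos_add_int_mul (n : ℕ) (δ l : ℝ) :
    Real.cos δ - Real.cos (δ + l * (2 * Real.pi / n)) =
      2 * Real.sin (δ + l * (Real.pi / n)) * Real.sin (l * (Real.pi / n)) := by
  rw [Real.cos_sub_cos, show (δ + (δ + l * (2 * Real.pi / n))) / 2 = δ + l * (Real.pi / n) by ring,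
    show (δ - (δ + l * (2 * Real.pi / n))) / 2 = -(l * (Real.pi / n)) by ring, Real.sin_neg]
  ring

theorem cos_add_int_mul_eq_emod {n : ℕ} (hn : 3 ≤ n) (δ : ℝ) (l : ℤ) :
    Real.cos (δ + l * (2 * Real.pi / n)) =
      Real.cos (δ + ((l % n : ℤ) : ℝ) * (2 * Real.pi / n)) := by
  have hn0 : (n : ℝ) ≠ 0 := by positivity
  have e : (l : ℝ) = ((l % n : ℤ) : ℝ) + n * ((l / n : ℤ) : ℝ) := by
    exact_mod_cast (Int.emod_add_mul_ediv l n).symm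
  rw [show δ + (l : ℝ) * (2 * Real.pi / n) = δ + ((l % n : ℤ) : ℝ) * (2 * Real.pi / n) +
    ((l / n : ℤ) : ℝ) * (2 * Real.pi) by rw [e]; field_simp; ring_nf,
    Real.cos_add_int_mul_two_pi]

/-- Among the angles congruent to `δ` modulo `2π/n`, the smallest has the largest cosine. -/
theorem cos_add_int_mul_le {n : ℕ} (hn : 3 ≤ n) {δ : ℝ} (h1 : -(Real.pi / n) ≤ δ)
    (h2 : δ ≤ Real.pi / n) (l : ℤ) : Real.cos (δ + l * (2 * Real.pi / n)) ≤ Real.cos δ := by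
  obtain ⟨b1, -, -⟩ := two_pi_div_bounds hn
  have hn0 : (n : ℝ) ≠ 0 := by positivity
  rw [cos_add_int_mul_eq_emod hn, ← sub_nonneg, cos_sub_cos_add_int_mul]
  have hp0 : 0 ≤ l % n := Int.emod_nonneg _ (by omega)
  have hpn : l % n < n := Int.emod_lt_of_pos _ (by omega)
  generalize l % n = p at hp0 hpn
  rcases hp0.eq_or_lt with rfl | hp
  · simp
  · have c1 : (1 : ℝ) ≤ p := by exact_mod_cast hp
    have c2 : (p : ℝ) ≤ n - 1 := by
      have : p ≤ n - 1 := by omega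
      exact_mod_cast this
    have e : Real.pi = n * (Real.pi / n) := by field_simp
    have d1 : 1 * (Real.pi / n) ≤ p * (Real.pi / n) := by gcongr
    have d2 : p * (Real.pi / n) ≤ (n - 1) * (Real.pi / n) := by gcongr
    have s1 := Real.sin_nonneg_of_nonneg_of_le_pi (x := δ + p * (Real.pi / n)) (by linarith)
      (by linarith)
    have s2 := Real.sin_nonneg_of_nonneg_of_le_pi (x := p * (Real.pi / n)) (by linarith)
      (by linarith)
    positivity

/-- The residue 1 has to be allowed because of the tie at δ = -π/n, where the two neighbouring
angles are opposite. It corresponds to a vertex of the inner polygon at a corner of the outer one.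
-/
theorem eq_of_cos_le_cos_add_int_mul {n : ℕ} (hn : 3 ≤ n) {δ : ℝ} (h1 : -(Real.pi / n) ≤ δ)
    (h2 : δ < Real.pi / n) (l : ℤ) (h : Real.cos δ ≤ Real.cos (δ + l * (2 * Real.pi / n))) :
    l % n = 0 ∨ l % n = 1 := by
  obtain ⟨b1, -, -⟩ := two_pi_div_bounds hn
  have hn0 : (n : ℝ) ≠ 0 := by positivity
  rw [cos_add_int_mul_eq_emod hn, ← sub_nonpos, cos_sub_cos_add_int_mul] at h
  have hp0 : 0 ≤ l % n := Int.emod_nonneg _ (by omega)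
  have hpn : l % n < n := Int.emod_lt_of_pos _ (by omega)
  generalize l % n = p at hp0 hpn h
  by_contra hcon
  have c1 : (2 : ℝ) ≤ p := by
    have : 2 ≤ p := by omega
    exact_mod_cast this
  have c2 : (p : ℝ) ≤ n - 1 := by
    have : p ≤ n - 1 := by omega
    exact_mod_cast this
  have e : Real.pi = n * (Real.pi / n) := by field_simp
  have d1 : 2 * (Real.pi / n) ≤ p * (Real.pi / n) := by gcongr
  have d2 : p * (Real.pi / n) ≤ (n - 1) * (Real.pi / n) := by gcongr
  have s1 := Real.sin_pos_of_pos_of_lt_pi (x := δ + p * (Real.pi / n)) (by linarith)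
    (by linarith)
  have s2 := Real.sin_pos_of_pos_of_lt_pi (x := p * (Real.pi / n)) (by linarith)
    (by linarith)
  have := mul_pos (mul_pos two_pos s1) s2
  linarith

theorem inner_ray_ray {n : ℕ} (A B : ℝ) (j k : ℕ) :
    inner ℝ (ray n A j) (ray n B k) =
      Real.cos (A - B + ((j - k : ℤ) : ℝ) * (2 * Real.pi / n)) := by
  rw [ray, ray, inner_dir_dir]; congr 1; push_cast; ring

theorem cross_ray_succ_sub {n : ℕ} (A : ℝ) (k : ℕ) (x : Plane) :
    cross x (ray n A (k + 1) - ray n A k) =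
      2 * Real.sin (Real.pi / n) * inner ℝ x (ray n (A + Real.pi / n) k) := by
  have key : ∀ M p : ℝ, cross x (dir (M + p) - dir (M - p)) =
      2 * Real.sin p * inner ℝ x (dir M) := by
    intro M p
    rw [inner_plane]
    simp only [cross, dir, Matrix.cons_val, PiLp.sub_apply, Real.sin_add, Real.sin_sub,
      Real.cos_add, Real.cos_sub]
    ring
  rw [ray_succ_eq, ray_shift, ray, ← key]
  congr 3 <;> ring_nf

theorem sin_two_pi_div (n : ℕ) : Real.sin (2 * Real.pi / n) =
    2 * Real.sin (Real.pi / n) * Real.cos (Real.pi / n) := by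
  rw [← Real.sin_two_mul]; congr 1; ring

theorem sum_ray {n : ℕ} (hn : 3 ≤ n) (A : ℝ) : ∑ k ∈ Finset.range n, ray n A k = 0 := by
  refine ext_inner_left ℝ fun d => ?_
  rw [inner_sum, sum_inner_ray hn, inner_zero_right]

/-! ### Regular polygons as intersections of half-planes, and their volume product. -/

theorem inner_le_of_mem_regularPolygon {n : ℕ} (hn : 3 ≤ n) {z : Plane} {r θ : ℝ} (hr : 0 ≤ r)
    {x : Plane} (hx : x ∈ regularPolygon n z r θ) (k : ℕ) :
    inner ℝ (x - z) (ray n (θ + Real.pi / n) k) ≤ r * Real.cos (Real.pi / n) := by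
  have hconv : Convex ℝ {x : Plane | inner ℝ (x - z) (ray n (θ + Real.pi / n) k) ≤
      r * Real.cos (Real.pi / n)} := by
    intro x hx y hy s t hs ht hst
    have e : s • x + t • y - z = s • (x - z) + t • (y - z) := by
      have : z = (s + t) • z := by rw [hst, one_smul]
      nth_rewrite 1 [this]; module
    simp only [Set.mem_ofPred_eq] at hx hy ⊢
    rw [e, inner_add_left, inner_smul_left, inner_smul_left]
    simp only [conj_trivial]
    have e2 : r * Real.cos (Real.pi / n) =
        s * (r * Real.cos (Real.pi / n)) + t * (r * Real.cos (Real.pi / n)) := by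
      rw [← add_mul, hst, one_mul]
    rw [e2]
    gcongr
  refine convexHull_min ?_ hconv hx
  rintro _ ⟨j, rfl⟩
  rw [Set.mem_ofPred_eq, regularVertex_eq, add_sub_cancel_left, inner_smul_left, inner_ray_ray]
  simp only [conj_trivial]
  refine mul_le_mul_of_nonneg_left ?_ hr
  have hb := (two_pi_div_bounds hn).1
  rw [show θ - (θ + Real.pi / n) = -(Real.pi / n) by ring, ← Real.cos_neg (Real.pi / n)]
  exact cos_add_int_mul_le hn le_rfl (by linarith) _

theorem mem_closedTriangle_of_inner_le {n : ℕ} (hn : 3 ≤ n) {r θ : ℝ} (hr : 0 < r) {k : ℕ}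
    {x : Plane} (h1 : 0 ≤ cross (ray n θ k) x) (h2 : 0 ≤ cross x (ray n θ (k + 1)))
    (h : inner ℝ x (ray n (θ + Real.pi / n) k) ≤ r * Real.cos (Real.pi / n)) :
    x ∈ closedTriangle (r • ray n θ k) (r • ray n θ (k + 1)) := by
  have hs := sin_pi_div_pos hn
  have key := cross_ray_succ_sub (n := n) θ k x
  rw [cross_sub_right, cross_swap x (ray n θ k)] at key
  simp only [closedTriangle, Set.mem_ofPred_eq, cross_smul_left, cross_smul_right,
    cross_ray_ray_succ, sin_two_pi_div]
  refine ⟨by positivity, by positivity, ?_⟩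
  have : r * (2 * Real.sin (Real.pi / n) * inner ℝ x (ray n (θ + Real.pi / n) k)) ≤
      r * (2 * Real.sin (Real.pi / n) * (r * Real.cos (Real.pi / n))) := by gcongr
  rw [← key] at this
  linarith

theorem regularVertex_mem (n : ℕ) (z : Plane) (r θ : ℝ) (k : ℕ) :
    z + r • ray n θ k ∈ regularPolygon n z r θ :=
  subset_convexHull ℝ _ ⟨k, rfl⟩

theorem center_mem_regularPolygon {n : ℕ} (hn : 3 ≤ n) (z : Plane) (r θ : ℝ) :
    z ∈ regularPolygon n z r θ := by
  have hn0 : (n : ℝ) ≠ 0 := by positivity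
  have key := (convex_convexHull ℝ (Set.range (regularVertex n z r θ))).sum_mem
    (t := Finset.range n) (w := fun _ => (1 / n : ℝ)) (z := fun k => z + r • ray n θ k)
    (fun _ _ => by positivity) (by simp [hn0]) (fun k _ => regularVertex_mem n z r θ k)
  rw [← Finset.smul_sum, Finset.sum_add_distrib, ← Finset.smul_sum, sum_ray hn] at key
  simp only [Finset.sum_const, Finset.card_range, smul_zero, add_zero,
    ← Nat.cast_smul_eq_nsmul ℝ] at key
  rwa [smul_smul, one_div_mul_cancel hn0, one_smul] at key

theorem mem_regularPolygon_of_inner_le {n : ℕ} (hn : 3 ≤ n) {z : Plane} {r θ : ℝ} (hr : 0 < r)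
    {x : Plane} (h : ∀ k < n, inner ℝ (x - z) (ray n (θ + Real.pi / n) k) ≤
      r * Real.cos (Real.pi / n)) : x ∈ regularPolygon n z r θ := by
  obtain ⟨k, hk, h1, h2⟩ := exists_ray_sector hn θ (x - z)
  obtain ⟨t1, t2, t3⟩ := mem_closedTriangle_of_inner_le hn hr h1 h2 (h k hk)
  have hab : 0 < cross (r • ray n θ k) (r • ray n θ (k + 1)) := by
    rw [cross_smul_left, cross_smul_right, cross_ray_ray_succ]
    have := sin_two_pi_div_pos hn
    positivity
  have hx := eq_cross_combination hab.ne' (x - z)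
  set s := cross (x - z) (r • ray n θ (k + 1)) / cross (r • ray n θ k) (r • ray n θ (k + 1))
    with hs
  set t := cross (r • ray n θ k) (x - z) / cross (r • ray n θ k) (r • ray n θ (k + 1)) with ht
  have hs0 : 0 ≤ s := div_nonneg t2 hab.le
  have ht0 : 0 ≤ t := div_nonneg t1 hab.le
  have hst : s + t ≤ 1 := by
    rw [hs, ht, ← add_div, div_le_one hab]; linarith
  have key := (convex_convexHull ℝ (Set.range (regularVertex n z r θ))).sum_mem
    (t := Finset.univ) (w := ![s, t, 1 - s - t])
    (z := ![z + r • ray n θ k, z + r • ray n θ (k + 1), z])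
    (by intro i _; fin_cases i <;> simp <;> linarith)
    (by simp [Fin.sum_univ_three])
    (by
      intro i _; fin_cases i
      · exact regularVertex_mem n z r θ k
      · exact regularVertex_mem n z r θ (k + 1)
      · exact center_mem_regularPolygon hn z r θ)
  simp only [Fin.sum_univ_three, Matrix.cons_val] at key
  have e : x = s • (z + r • ray n θ k) + t • (z + r • ray n θ (k + 1)) + (1 - s - t) • z := by
    rw [← sub_add_cancel x z, hx]; module
  rw [e]; exact key

/-- Upper bound for the area of a regular polygon given by its sides. -/
theorem volume_le_of_inner_le {n : ℕ} (hn : 3 ≤ n) {P : Set Plane} {r θ : ℝ} (hr : 0 < r)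
    (h : ∀ x ∈ P, ∀ k < n, inner ℝ x (ray n (θ + Real.pi / n) k) ≤ r * Real.cos (Real.pi / n)) :
    volume.real P ≤ n * (r ^ 2 * Real.sin (2 * Real.pi / n) / 2) := by
  have hs := sin_two_pi_div_pos hn
  have hcr : ∀ k, cross (r • ray n θ k) (r • ray n θ (k + 1)) =
      r ^ 2 * Real.sin (2 * Real.pi / n) := by
    intro k; rw [cross_smul_left, cross_smul_right, cross_ray_ray_succ]; ring
  have hsub : P ⊆ ⋃ k ∈ Finset.range n, closedTriangle (r • ray n θ k) (r • ray n θ (k + 1)) := by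
    intro x hx
    obtain ⟨k, hk, h1, h2⟩ := exists_ray_sector hn θ x
    exact Set.mem_biUnion (Finset.mem_coe.2 (Finset.mem_range.2 hk))
      (mem_closedTriangle_of_inner_le hn hr h1 h2 (h x hx k hk))
  have hle : volume P ≤ ENNReal.ofReal (n * (r ^ 2 * Real.sin (2 * Real.pi / n) / 2)) :=
    calc volume P ≤ ∑ k ∈ Finset.range n,
          volume (closedTriangle (r • ray n θ k) (r • ray n θ (k + 1))) :=
          (measure_mono hsub).trans (measure_biUnion_finset_le _ _)
      _ ≤ ∑ _k ∈ Finset.range n, ENNReal.ofReal (r ^ 2 * Real.sin (2 * Real.pi / n) / 2) := by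
          refine Finset.sum_le_sum fun k _ => ?_
          rw [← hcr k]
          exact volume_closedTriangle_le (by rw [hcr]; positivity)
      _ = ENNReal.ofReal (n * (r ^ 2 * Real.sin (2 * Real.pi / n) / 2)) := by
          rw [Finset.sum_const, Finset.card_range, nsmul_eq_mul,
            ENNReal.ofReal_mul (Nat.cast_nonneg n), ENNReal.ofReal_natCast]
  exact ENNReal.toReal_le_of_le_ofReal (by positivity) hle

/-- The vertices bound the polar by a regular `n`-gon of inradius 1/r. Upper bounds for both areas
suffice, since the main inequality supplies the converse. -/
theorem volumeProduct_regularPolygon_le {n : ℕ} (hn : 3 ≤ n) {r θ : ℝ} (hr : 0 < r) :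
    volumeProduct (regularPolygon n 0 r θ) ≤ (n : ℝ) ^ 2 * Real.sin (Real.pi / n) ^ 2 := by
  have hc := cos_pi_div_pos hn
  have hs := sin_pi_div_pos hn
  have h1 : volume.real (regularPolygon n 0 r θ) ≤ n * (r ^ 2 * Real.sin (2 * Real.pi / n) / 2) :=
    volume_le_of_inner_le (θ := θ) hn hr fun x hx k _ => by
      simpa using inner_le_of_mem_regularPolygon hn hr.le hx k
  have h2 : volume.real (polarSet (regularPolygon n 0 r θ)) ≤
      n * ((1 / (r * Real.cos (Real.pi / n))) ^ 2 * Real.sin (2 * Real.pi / n) / 2) := by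
    refine volume_le_of_inner_le (θ := θ - Real.pi / n) hn (by positivity) fun x hx k _ => ?_
    have h3 := hx _ (regularVertex_mem n 0 r θ k)
    rw [zero_add, inner_smul_right] at h3
    rw [sub_add_cancel]
    rw [show 1 / (r * Real.cos (Real.pi / n)) * Real.cos (Real.pi / n) = 1 / r by field_simp,
      le_div_iff₀ hr]
    linarith
  calc volumeProduct (regularPolygon n 0 r θ) ≤
      (n * (r ^ 2 * Real.sin (2 * Real.pi / n) / 2)) *
        (n * ((1 / (r * Real.cos (Real.pi / n))) ^ 2 * Real.sin (2 * Real.pi / n) / 2)) :=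
        mul_le_mul h1 h2 measureReal_nonneg (by
          have := sin_two_pi_div_pos hn
          positivity)
    _ = (n : ℝ) ^ 2 * Real.sin (Real.pi / n) ^ 2 := by
        rw [sin_two_pi_div]; field_simp

/-! ### Two scalar inequalities with their equality cases. -/

/-- Let v be the square root and w = αs + βt. Cauchy–Schwarz gives v²w ≥ 1, and AM–GM for v, v, w
then gives 2v + w ≥ 3; the identity `hid` combines the two. Equality requires v = w = 1, so that
every variable of nonzero weight is 1. -/
theorem inner_div_sqrt_bound {α β s t : ℝ} (hα : 0 ≤ α) (hβ : 0 ≤ β) (hαβ : α + β = 1)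
    (hs : 0 < s) (ht : 0 < t) :
    (3 - (α * s + β * t)) / 2 ≤ Real.sqrt (α / s + β / t) ∧
      (Real.sqrt (α / s + β / t) ≤ (3 - (α * s + β * t)) / 2 →
        (α = 0 ∨ s = 1) ∧ (β = 0 ∨ t = 1)) := by
  set v := Real.sqrt (α / s + β / t) with hv
  set w := α * s + β * t with hw
  have hv2 : v ^ 2 = α / s + β / t := Real.sq_sqrt (by positivity)
  have hprod : v ^ 2 * w = 1 + α * β * (s - t) ^ 2 / (s * t) := by
    rw [hv2, hw]; field_simp
    obtain rfl : β = 1 - α := by linarith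
    ring
  have hv0 : 0 ≤ v := Real.sqrt_nonneg _
  have hge : 1 ≤ v ^ 2 * w := by
    rw [hprod]; have : 0 ≤ α * β * (s - t) ^ 2 / (s * t) := by positivity
    linarith
  have hvpos : 0 < v := lt_of_le_of_ne hv0 fun h => by rw [← h] at hge; norm_num at hge
  have hamgm : 0 ≤ (v - 1) ^ 2 * (2 * v + 1) := by positivity
  have hid : v ^ 2 * (2 * v + w - 3) = (v - 1) ^ 2 * (2 * v + 1) + (v ^ 2 * w - 1) := by ring
  have hv2pos : 0 < v ^ 2 := by positivity
  refine ⟨?_, fun hle => ?_⟩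
  · have : 0 ≤ 2 * v + w - 3 :=
      nonneg_of_mul_nonneg_right (by rw [hid]; linarith) hv2pos
    linarith
  · have h1 : v ^ 2 * (2 * v + w - 3) ≤ 0 :=
      mul_nonpos_of_nonneg_of_nonpos hv2pos.le (by linarith)
    have h2 : (v - 1) ^ 2 * (2 * v + 1) = 0 := by linarith
    have hv1 : v = 1 := by
      rcases mul_eq_zero.1 h2 with h | h
      · have := pow_eq_zero_iff (two_ne_zero) |>.1 h; linarith
      · linarith
    have h3 : v ^ 2 * w = 1 := by linarith
    have hw1 : w = 1 := by rw [hv1] at h3; linarith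
    rw [h3] at hprod
    have h4 : α * β * (s - t) ^ 2 / (s * t) = 0 := by linarith
    have h5 : α * β * (s - t) ^ 2 = 0 := by
      rcases div_eq_zero_iff.1 h4 with h | h
      · exact h
      · exact absurd h (by positivity)
    rcases mul_eq_zero.1 h5 with h | h
    · rcases mul_eq_zero.1 h with h | h
      · refine ⟨Or.inl h, Or.inr ?_⟩
        rw [h] at hαβ hw
        have : β = 1 := by linarith
        rw [this] at hw; linarith
      · refine ⟨Or.inr ?_, Or.inl h⟩
        rw [h] at hαβ hw
        have : α = 1 := by linarith
        rw [this] at hw; linarith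
    · have hst : s = t := by have := pow_eq_zero_iff (two_ne_zero) |>.1 h; linarith
      have : t = 1 := by
        rw [hst, ← add_mul, hαβ, one_mul] at hw; linarith
      exact ⟨Or.inr (hst.trans this), Or.inr this⟩

/-- Equality case of Cauchy–Schwarz: expanding ∑ (S_k - X/n)²/S_k, with X the sum of the S_k, gives
zero. -/
theorem eq_of_sum_mul_sum_inv {n : ℕ} {S : ℕ → ℝ} {σ : ℝ} (hσ : 0 < σ)
    (hS : ∀ k ∈ Finset.range n, 0 < S k)
    (h : (∑ k ∈ Finset.range n, S k) * ∑ k ∈ Finset.range n, σ ^ 2 / S k = (n * σ) ^ 2) :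
    ∀ k ∈ Finset.range n, S k = (∑ k ∈ Finset.range n, S k) / n := by
  intro k hk
  have hn : (n : ℝ) ≠ 0 := by
    have : 0 < n := by have := Finset.mem_range.1 hk; omega
    positivity
  set X := ∑ k ∈ Finset.range n, S k with hX
  have hR : ∑ k ∈ Finset.range n, σ ^ 2 / S k = σ ^ 2 * ∑ k ∈ Finset.range n, (S k)⁻¹ := by
    rw [Finset.mul_sum]; rfl
  rw [hR] at h
  have h' : X * ∑ k ∈ Finset.range n, (S k)⁻¹ = n ^ 2 := by
    have : σ ^ 2 * (X * ∑ k ∈ Finset.range n, (S k)⁻¹) = σ ^ 2 * n ^ 2 := by linarith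
    exact mul_left_cancel₀ (by positivity) this
  have hsum : ∑ k ∈ Finset.range n, (S k - X / n) ^ 2 / S k = 0 := by
    have e : ∀ k ∈ Finset.range n, (S k - X / n) ^ 2 / S k =
        S k - 2 * (X / n) + (X / n) ^ 2 * (S k)⁻¹ := by
      intro k hk; have := (hS k hk).ne'; field_simp; ring
    rw [Finset.sum_congr rfl e, Finset.sum_add_distrib, Finset.sum_sub_distrib, ← Finset.mul_sum,
      ← hX, Finset.sum_const, Finset.card_range, nsmul_eq_mul]
    have : (X / n) ^ 2 * ∑ k ∈ Finset.range n, (S k)⁻¹ =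
        X / n ^ 2 * (X * ∑ k ∈ Finset.range n, (S k)⁻¹) := by ring
    rw [← Finset.mul_sum, this, h']; field_simp; ring
  have h0 := (Finset.sum_eq_zero_iff_of_nonneg fun k hk =>
    div_nonneg (sq_nonneg (S k - X / n)) (hS k hk).le).1 hsum k hk
  rcases div_eq_zero_iff.1 h0 with h1 | h1
  · have := pow_eq_zero_iff (two_ne_zero) |>.1 h1; linarith
  · exact absurd h1 (hS k hk).ne'

/-! ### Polar sets -/

theorem polarSet_eq_iInter (K : Set Plane) :
    polarSet K = ⋂ y ∈ K, {x : Plane | inner ℝ x y ≤ 1} := by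
  ext x; simp [polarSet]

theorem isClosed_polarSet (K : Set Plane) : IsClosed (polarSet K) := by
  rw [polarSet_eq_iInter]
  exact isClosed_biInter fun y _ => isClosed_le (by fun_prop) continuous_const

theorem convex_polarSet (K : Set Plane) : Convex ℝ (polarSet K) := by
  intro x hx y hy s t hs ht hst v hv
  rw [inner_add_left, inner_smul_left, inner_smul_left]
  simp only [conj_trivial]
  have h1 := mul_le_mul_of_nonneg_left (hx v hv) hs
  have h2 := mul_le_mul_of_nonneg_left (hy v hv) ht
  linarith

theorem zero_mem_polarSet (K : Set Plane) : (0 : Plane) ∈ polarSet K := by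
  intro y _; simp

namespace IsConvexBodyAroundOrigin

variable {K : Set Plane}

theorem exists_smul_mem (hK : IsConvexBodyAroundOrigin K) :
    ∃ ε : ℝ, 0 < ε ∧ ∀ v : Plane, ‖v‖ ≤ ε → v ∈ K := by
  obtain ⟨ε, hε, hsub⟩ := Metric.isOpen_iff.1 isOpen_interior 0 hK.zero_mem_interior
  refine ⟨ε / 2, by positivity, fun v hv => interior_subset (hsub ?_)⟩
  rw [mem_ball_zero_iff]; linarith

theorem zero_mem (hK : IsConvexBodyAroundOrigin K) : (0 : Plane) ∈ K :=
  interior_subset hK.zero_mem_interior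

theorem exists_pos_smul_mem (hK : IsConvexBodyAroundOrigin K) (v : Plane) :
    ∃ t : ℝ, 0 < t ∧ t • v ∈ K := by
  obtain ⟨ε, hε, h⟩ := hK.exists_smul_mem
  refine ⟨ε / (‖v‖ + 1), by positivity, h _ ?_⟩
  rw [norm_smul, Real.norm_of_nonneg (by positivity), div_mul_eq_mul_div,
    div_le_iff₀ (by positivity)]
  nlinarith [norm_nonneg v]

theorem volume_polarSet_ne_top (hK : IsConvexBodyAroundOrigin K) : volume (polarSet K) ≠ ⊤ := by
  obtain ⟨ε, hε, h⟩ := hK.exists_smul_mem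
  have hsub : polarSet K ⊆ Metric.closedBall 0 (1 / ε) := by
    intro x hx
    rw [mem_closedBall_zero_iff, le_div_iff₀ hε]
    rcases eq_or_ne x 0 with rfl | hx0
    · simp
    · have hn : 0 < ‖x‖ := norm_pos_iff.2 hx0
      have := hx ((ε / ‖x‖) • x) (h _ (by
        rw [norm_smul, Real.norm_of_nonneg (by positivity)]; field_simp; rfl))
      rw [inner_smul_right, real_inner_self_eq_norm_sq] at this
      calc ‖x‖ * ε = ε / ‖x‖ * ‖x‖ ^ 2 := by field_simp
        _ ≤ 1 := this
  exact measure_ne_top_of_subset hsub measure_closedBall_lt_top.ne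

theorem volume_ne_top (hK : IsConvexBodyAroundOrigin K) : volume K ≠ ⊤ :=
  hK.isCompact.measure_lt_top.ne

end IsConvexBodyAroundOrigin

/-- The vector representing the functional `x ↦ cross x g`. -/
def perp (g : Plane) : Plane := !₂[g 1, -g 0]

theorem inner_perp_left (g x : Plane) : inner ℝ (perp g) x = cross x g := by
  rw [inner_plane]; simp only [perp, cross, Matrix.cons_val]; ring

theorem cross_perp_left (g f : Plane) : cross (perp g) f = inner ℝ g f := by
  rw [inner_plane]; simp only [perp, cross, Matrix.cons_val]; ring

/-! ### Fans of the body and of its polar. -/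

/-- A convex body `K` between two concentric regular `n`-gons: the inner one has circumradius `r`
and a vertex at angle `φ + δ`, the outer one has inradius `ρ` and an edge normal at angle `φ`. -/
structure BetweenPolygons (n : ℕ) (z : Plane) (ρ r φ δ : ℝ) (K : Set Plane) : Prop where
  three_le : 3 ≤ n
  body : IsConvexBodyAroundOrigin K
  inradius_pos : 0 < ρ
  circumradius_pos : 0 < r
  neg_le : -(Real.pi / n) ≤ δ
  le : δ ≤ Real.pi / n
  radii : r * Real.cos δ = ρ
  vertex_mem : ∀ k, z + r • ray n (φ + δ) k ∈ K
  inner_le : ∀ x ∈ K, ∀ k, inner ℝ (x - z) (ray n φ k) ≤ ρ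

/-- The distance from the origin to the line `⟨x - z, ray n φ k⟩ = ρ`. -/
noncomputable def sideDist (n : ℕ) (z : Plane) (ρ φ : ℝ) (k : ℕ) : ℝ :=
  ρ + inner ℝ z (ray n φ k)

/-- The pole of the line `⟨x - z, ray n φ k⟩ = ρ`. -/
noncomputable def sidePole (n : ℕ) (z : Plane) (ρ φ : ℝ) (k : ℕ) : Plane :=
  (sideDist n z ρ φ k)⁻¹ • ray n φ k

namespace BetweenPolygons

variable {n : ℕ} {z : Plane} {ρ r φ δ : ℝ} {K : Set Plane}

theorem sideDist_pos (P : BetweenPolygons n z ρ r φ δ K) (k : ℕ) : 0 < sideDist n z ρ φ k := by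
  obtain ⟨t, ht, hmem⟩ := P.body.exists_pos_smul_mem (ray n φ k)
  have h := P.inner_le _ hmem k
  rw [inner_sub_left, inner_smul_left, ray, inner_dir_dir, sub_self, Real.cos_zero] at h
  simp only [conj_trivial, mul_one] at h
  unfold sideDist ray; linarith

theorem sidePole_mem (P : BetweenPolygons n z ρ r φ δ K) (k : ℕ) :
    sidePole n z ρ φ k ∈ polarSet K := by
  intro x hx
  have h := P.inner_le x hx k
  have hp := P.sideDist_pos k
  rw [sidePole, inner_smul_left]
  simp only [conj_trivial]
  rw [inv_mul_le_one₀ hp, sideDist, real_inner_comm]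
  rw [inner_sub_left] at h
  linarith

theorem inner_vertex_sub (P : BetweenPolygons n z ρ r φ δ K) (k : ℕ) :
    inner ℝ (r • ray n (φ + δ) k) (ray n φ k) = ρ := by
  rw [inner_smul_left, inner_ray_ray, sub_self]
  simp only [conj_trivial, Int.cast_zero, zero_mul, add_zero, add_sub_cancel_left]
  exact P.radii

theorem inner_vertex_sidePole (P : BetweenPolygons n z ρ r φ δ K) (k : ℕ) :
    inner ℝ (z + r • ray n (φ + δ) k) (sidePole n z ρ φ k) = 1 := by
  rw [sidePole, inner_smul_right, inner_add_left, P.inner_vertex_sub, sideDist, add_comm]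
  exact inv_mul_cancel₀ (by rw [add_comm]; exact (P.sideDist_pos k).ne')

/-- The vertex of the inner polygon on the `k`-th side line, read as a functional, supports the
polar body at the pole of that line. -/
theorem fan_polar (P : BetweenPolygons n z ρ r φ δ K) :
    SupportedFan n φ (polarSet K) (sidePole n z ρ φ) where
  convex := convex_polarSet K
  isClosed := isClosed_polarSet K
  finite := P.body.volume_polarSet_ne_top
  zero_mem := zero_mem_polarSet K
  mem := P.sidePole_mem
  direction k := ⟨_, inv_pos.2 (P.sideDist_pos k), rfl⟩
  support k := ⟨z + r • ray n (φ + δ) k, P.inner_vertex_sidePole k, fun x hx => by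
    rw [real_inner_comm]; exact hx _ (P.vertex_mem k)⟩

theorem center_mem (P : BetweenPolygons n z ρ r φ δ K) : z ∈ K := by
  refine (convexHull_min ?_ P.body.convex) (center_mem_regularPolygon P.three_le z r (φ + δ))
  rintro _ ⟨k, rfl⟩
  exact P.vertex_mem k

theorem volume_translate (K : Set Plane) (z : Plane) :
    volume.real ((fun v => v + z) ⁻¹' K) = volume.real K := by
  rw [Measure.real, measure_preimage_add_right, Measure.real]

/-- The vertices are equally spaced as seen from `z`, whereas the poles are so as seen from the
origin; hence the translation here and none in `fan_polar`. -/
theorem fan_body (P : BetweenPolygons n z ρ r φ δ K) :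
    SupportedFan n (φ + δ) ((fun v => v + z) ⁻¹' K) (fun k => r • ray n (φ + δ) k) where
  convex := P.body.convex.translate_preimage_left z
  isClosed := P.body.isCompact.isClosed.preimage (by fun_prop)
  finite := by rw [measure_preimage_add_right]; exact P.body.volume_ne_top
  zero_mem := by simpa using P.center_mem
  mem k := by
    rw [Set.mem_preimage, add_comm]; exact P.vertex_mem k
  direction k := ⟨r, P.circumradius_pos, rfl⟩
  support k := by
    have hρ := P.inradius_pos
    refine ⟨ρ⁻¹ • ray n φ k, ?_, fun x hx => ?_⟩
    · rw [inner_smul_left, real_inner_comm, P.inner_vertex_sub]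
      exact inv_mul_cancel₀ hρ.ne'
    · have := P.inner_le _ hx k
      rw [add_sub_cancel_right] at this
      rw [inner_smul_left, real_inner_comm]
      exact (inv_mul_le_one₀ hρ).2 this

end BetweenPolygons

/-! ### The area bound. -/

namespace BetweenPolygons

variable {n : ℕ} {z : Plane} {ρ r φ δ : ℝ} {K : Set Plane}

/-- The side vectors of the inner polygon. -/
noncomputable def sideVec (n : ℕ) (r A : ℝ) (k : ℕ) : Plane := r • ray n A (k + 1) - r • ray n A k

/-- The side vectors of the polar of the outer polygon. -/
noncomputable def poleVec (n : ℕ) (z : Plane) (ρ φ : ℝ) (k : ℕ) : Plane :=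
  sidePole n z ρ φ (k + 1) - sidePole n z ρ φ k

theorem cross_sideVec (r A : ℝ) (k : ℕ) (x : Plane) : cross x (sideVec n r A k) =
    r * (2 * Real.sin (Real.pi / n)) * inner ℝ x (ray n (A + Real.pi / n) k) := by
  rw [sideVec, ← smul_sub, cross_smul_right, cross_ray_succ_sub]; ring

theorem sum_cross_sideVec (hn : 3 ≤ n) (r A : ℝ) (x : Plane) :
    ∑ k ∈ Finset.range n, cross x (sideVec n r A k) = 0 := by
  rw [Finset.sum_congr rfl fun k _ => cross_sideVec r A k x, ← Finset.mul_sum, sum_inner_ray hn,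
    mul_zero]

/-- The weight of the distance to the `k`-th side in `inner_sideVec_poleVec`; `weight n (-δ)` is the
weight of the distance to the next side. -/
noncomputable def weight (n : ℕ) (δ : ℝ) : ℝ :=
  (Real.cos δ - Real.cos (δ + 2 * Real.pi / n)) / (4 * Real.sin (Real.pi / n) ^ 2 * Real.cos δ)

theorem cos_pos (P : BetweenPolygons n z ρ r φ δ K) : 0 < Real.cos δ := by
  have := P.inradius_pos
  rw [← P.radii] at this
  exact pos_of_mul_pos_right this P.circumradius_pos.le

theorem weight_nonneg (P : BetweenPolygons n z ρ r φ δ K) :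
    0 ≤ weight n δ ∧ 0 ≤ weight n (-δ) := by
  have hc := P.cos_pos
  have h1 := cos_add_int_mul_le P.three_le P.neg_le P.le 1
  have h2 := cos_add_int_mul_le P.three_le (neg_le_neg P.le) (_root_.neg_le.1 P.neg_le) 1
  rw [Int.cast_one, one_mul] at h1 h2
  refine ⟨div_nonneg (by linarith) (by positivity), div_nonneg (by linarith) ?_⟩
  rw [Real.cos_neg]; positivity

theorem weight_add (P : BetweenPolygons n z ρ r φ δ K) : weight n δ + weight n (-δ) = 1 := by
  have hc := P.cos_pos
  have hs := sin_pi_div_pos P.three_le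
  have e : Real.cos (δ + 2 * Real.pi / n) + Real.cos (-δ + 2 * Real.pi / n) =
      2 * Real.cos δ * (1 - 2 * Real.sin (Real.pi / n) ^ 2) := by
    rw [← Real.cos_two_mul_eq_one_sub, Real.cos_add, Real.cos_add, Real.cos_neg, Real.sin_neg,
      (two_pi_div_bounds P.three_le).2.2]
    ring
  unfold weight
  rw [Real.cos_neg, ← add_div, div_eq_one_iff_eq (by positivity)]
  linarith

/-- The vertices at `k` and `k + 1` make the angle δ with the normals of the same index and the
angles δ ± 2π/n with those of the other index. Expanding the product and collecting the reciprocals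
of the two distances gives the weights. -/
theorem inner_sideVec_poleVec (P : BetweenPolygons n z ρ r φ δ K) (k : ℕ) :
    inner ℝ (sideVec n r (φ + δ) k) (poleVec n z ρ φ k) =
      4 * Real.sin (Real.pi / n) ^ 2 * (weight n δ / (sideDist n z ρ φ k / ρ) +
        weight n (-δ) / (sideDist n z ρ φ (k + 1) / ρ)) := by
  have h1 := P.sideDist_pos k
  have h2 := P.sideDist_pos (k + 1)
  have hs := sin_pi_div_pos P.three_le
  have hc := P.cos_pos
  have hr := P.circumradius_pos
  simp only [sideVec, poleVec, sidePole, inner_sub_left, inner_sub_right, inner_smul_left,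
    inner_smul_right, inner_ray_ray, conj_trivial]
  have a1 : φ + δ - φ + (((k + 1 : ℕ) - (k + 1 : ℕ) : ℤ) : ℝ) * (2 * Real.pi / n) = δ := by
    push_cast; ring
  have a2 : φ + δ - φ + (((k : ℕ) - (k : ℕ) : ℤ) : ℝ) * (2 * Real.pi / n) = δ := by
    push_cast; ring
  have a3 : φ + δ - φ + (((k + 1 : ℕ) - (k : ℕ) : ℤ) : ℝ) * (2 * Real.pi / n) =
    δ + 2 * Real.pi / n := by push_cast; ring
  have a4 : φ + δ - φ + (((k : ℕ) - (k + 1 : ℕ) : ℤ) : ℝ) * (2 * Real.pi / n) =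
    -(-δ + 2 * Real.pi / n) := by push_cast; ring
  rw [a1, a2, a3, a4, Real.cos_neg (-δ + 2 * Real.pi / n)]
  unfold weight
  rw [Real.cos_neg δ, ← P.radii]
  field_simp
  ring

theorem sum_sideDist (P : BetweenPolygons n z ρ r φ δ K) :
    ∑ k ∈ Finset.range n, sideDist n z ρ φ k / ρ = n ∧
      ∑ k ∈ Finset.range n, sideDist n z ρ φ (k + 1) / ρ = n := by
  have hρ := P.inradius_pos
  have hshift : ∀ k, ray n φ (k + 1) = ray n (φ + 2 * Real.pi / n) k := by
    intro k; rw [ray_succ_eq, ray_shift]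
  unfold sideDist
  simp only [hshift, ← Finset.sum_div, Finset.sum_add_distrib, sum_inner_ray P.three_le]
  simp [hρ.ne']

theorem sideVec_ne_zero (P : BetweenPolygons n z ρ r φ δ K) (k : ℕ) :
    sideVec n r (φ + δ) k ≠ 0 := by
  intro h
  have h1 := cross_sideVec (n := n) r (φ + δ) k (ray n (φ + δ + Real.pi / n) k)
  rw [h, ray, inner_dir_dir, sub_self, Real.cos_zero] at h1
  have hs := sin_pi_div_pos P.three_le
  have hr := P.circumradius_pos
  have : (0 : ℝ) < r * (2 * Real.sin (Real.pi / n)) * 1 := by positivity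
  rw [← h1] at this
  simp [cross] at this

theorem exists_cap_points (P : BetweenPolygons n z ρ r φ δ K) :
    ∃ q : ℕ → Plane, ∀ k, q k ∈ K ∧ 0 < cross (q k) (sideVec n r (φ + δ) k) ∧
      ∀ x ∈ K, cross x (sideVec n r (φ + δ) k) ≤ cross (q k) (sideVec n r (φ + δ) k) := by
  have h : ∀ k, ∃ q ∈ K, 0 < cross q (sideVec n r (φ + δ) k) ∧
      ∀ x ∈ K, cross x (sideVec n r (φ + δ) k) ≤ cross q (sideVec n r (φ + δ) k) := by
    intro k
    obtain ⟨q, hq, hmax⟩ := P.body.isCompact.exists_isMaxOn ⟨0, P.body.zero_mem⟩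
      (continuous_cross_left (sideVec n r (φ + δ) k)).continuousOn
    refine ⟨q, hq, ?_, fun x hx => hmax hx⟩
    obtain ⟨t, ht, hmem⟩ := P.body.exists_pos_smul_mem (perp (sideVec n r (φ + δ) k))
    refine lt_of_lt_of_le ?_ (hmax hmem)
    change 0 < cross _ _
    rw [cross_smul_left, cross_perp_left]
    exact mul_pos ht (real_inner_self_pos.2 (P.sideVec_ne_zero k))
  choose q hq using h
  exact ⟨q, hq⟩

/-- The point of the polar body dual to the support line of `K` at `q` in direction `g`. -/
noncomputable def capPole (g q : Plane) : Plane := (cross q g)⁻¹ • perp g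

theorem inner_capPole (g q x : Plane) :
    inner ℝ (capPole g q) x = (cross q g)⁻¹ * cross x g := by
  rw [capPole, inner_smul_left, inner_perp_left]; rfl

theorem capPole_mem {g q : Plane} (hpos : 0 < cross q g) (h : ∀ x ∈ K, cross x g ≤ cross q g) :
    capPole g q ∈ polarSet K := by
  intro x hx
  rw [inner_capPole, inv_mul_le_one₀ hpos]
  exact h x hx

theorem cross_capPole (g q f : Plane) : cross (capPole g q) f = (cross q g)⁻¹ * inner ℝ g f := by
  rw [capPole, cross_smul_left, cross_perp_left]

/-- The side vectors sum to zero, so the base point does not matter. This lets the body be dissected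
from `z` and still be paired with the polar about the origin. -/
theorem sum_cap_eq (P : BetweenPolygons n z ρ r φ δ K) (q : ℕ → Plane) :
    ∑ k ∈ Finset.range n, cross (q k - z) (sideVec n r (φ + δ) k) / 2 =
      ∑ k ∈ Finset.range n, cross (q k) (sideVec n r (φ + δ) k) / 2 := by
  simp only [← Finset.sum_div, cross_sub_left, Finset.sum_sub_distrib,
    sum_cross_sideVec P.three_le, sub_zero]

theorem sum_cap_le (P : BetweenPolygons n z ρ r φ δ K) {q : ℕ → Plane} (hq : ∀ k, q k ∈ K) :
    ∑ k ∈ Finset.range n, cross (q k) (sideVec n r (φ + δ) k) / 2 ≤ volume.real K := by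
  rw [← P.sum_cap_eq, ← volume_translate K z]
  exact P.fan_body.sum_cross_le P.three_le fun k _ => by simpa using hq k

theorem sum_capPole_le (P : BetweenPolygons n z ρ r φ δ K) {q : ℕ → Plane}
    (hpos : ∀ k, 0 < cross (q k) (sideVec n r (φ + δ) k))
    (hmax : ∀ k, ∀ x ∈ K, cross x (sideVec n r (φ + δ) k) ≤
      cross (q k) (sideVec n r (φ + δ) k)) :
    ∑ k ∈ Finset.range n, cross (capPole (sideVec n r (φ + δ) k) (q k)) (poleVec n z ρ φ k) / 2 ≤
      volume.real (polarSet K) :=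
  P.fan_polar.sum_cross_le P.three_le fun k _ => capPole_mem (hpos k) (hmax k)

/-- The square root of the area product of the `k`-th caps, and its lower bound. -/
theorem sqrt_cap_bound (P : BetweenPolygons n z ρ r φ δ K) (k : ℕ) :
    let t := Real.sqrt (inner ℝ (sideVec n r (φ + δ) k) (poleVec n z ρ φ k) / 4)
    let b := Real.sin (Real.pi / n) * ((3 - (weight n δ * (sideDist n z ρ φ k / ρ) +
      weight n (-δ) * (sideDist n z ρ φ (k + 1) / ρ))) / 2)
    b ≤ t ∧ (t ≤ b → (weight n δ = 0 ∨ sideDist n z ρ φ k / ρ = 1) ∧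
      (weight n (-δ) = 0 ∨ sideDist n z ρ φ (k + 1) / ρ = 1)) := by
  intro t b
  have hρ := P.inradius_pos
  have hs := sin_pi_div_pos P.three_le
  obtain ⟨w1, w2⟩ := P.weight_nonneg
  obtain ⟨h1, h2⟩ := inner_div_sqrt_bound w1 w2 P.weight_add (div_pos (P.sideDist_pos k) hρ)
    (div_pos (P.sideDist_pos (k + 1)) hρ)
  have ht : t = Real.sin (Real.pi / n) * Real.sqrt (weight n δ / (sideDist n z ρ φ k / ρ) +
      weight n (-δ) / (sideDist n z ρ φ (k + 1) / ρ)) := by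
    simp only [t]
    rw [P.inner_sideVec_poleVec, mul_assoc, mul_div_cancel_left₀ _ (by norm_num : (4 : ℝ) ≠ 0),
      Real.sqrt_mul (sq_nonneg _), Real.sqrt_sq hs.le]
  rw [ht]
  exact ⟨mul_le_mul_of_nonneg_left h1 hs.le, fun h => h2 (le_of_mul_le_mul_left h hs)⟩

theorem sum_bound (P : BetweenPolygons n z ρ r φ δ K) :
    ∑ k ∈ Finset.range n, Real.sin (Real.pi / n) * ((3 - (weight n δ * (sideDist n z ρ φ k / ρ) +
      weight n (-δ) * (sideDist n z ρ φ (k + 1) / ρ))) / 2) = n * Real.sin (Real.pi / n) := by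
  obtain ⟨s1, s2⟩ := P.sum_sideDist
  rw [← Finset.mul_sum, ← Finset.sum_div, Finset.sum_sub_distrib, Finset.sum_add_distrib,
    ← Finset.mul_sum, ← Finset.mul_sum, s1, s2, ← add_mul, P.weight_add]
  simp; ring

theorem inner_sideVec_poleVec_pos (P : BetweenPolygons n z ρ r φ δ K) (k : ℕ) :
    0 < inner ℝ (sideVec n r (φ + δ) k) (poleVec n z ρ φ k) := by
  have hρ := P.inradius_pos
  have hs := sin_pi_div_pos P.three_le
  obtain ⟨w1, w2⟩ := P.weight_nonneg
  have h1 := div_pos (P.sideDist_pos k) hρ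
  have h2 := div_pos (P.sideDist_pos (k + 1)) hρ
  rw [P.inner_sideVec_poleVec]
  refine mul_pos (by positivity) ?_
  rcases w1.eq_or_lt with h | h
  -- If the first weight vanishes, the second one is 1.
  · have := P.weight_add
    rw [← h] at this ⊢
    rw [zero_add] at this
    rw [this]; positivity
  · positivity

/-- The area bound, with the consequences of equality. -/
theorem volumeProduct_bound (P : BetweenPolygons n z ρ r φ δ K) {q : ℕ → Plane}
    (hq : ∀ k, q k ∈ K) (hpos : ∀ k, 0 < cross (q k) (sideVec n r (φ + δ) k))
    (hmax : ∀ k, ∀ x ∈ K, cross x (sideVec n r (φ + δ) k) ≤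
      cross (q k) (sideVec n r (φ + δ) k)) :
    (n : ℝ) ^ 2 * Real.sin (Real.pi / n) ^ 2 ≤ volumeProduct K ∧
    (volumeProduct K = (n : ℝ) ^ 2 * Real.sin (Real.pi / n) ^ 2 →
      (∑ k ∈ Finset.range n, cross (q k) (sideVec n r (φ + δ) k) / 2 = volume.real K ∧
        ∑ k ∈ Finset.range n,
          cross (capPole (sideVec n r (φ + δ) k) (q k)) (poleVec n z ρ φ k) / 2 =
          volume.real (polarSet K)) ∧
      ∀ k ∈ Finset.range n, (weight n δ = 0 ∨ sideDist n z ρ φ k / ρ = 1) ∧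
        (weight n (-δ) = 0 ∨ sideDist n z ρ φ (k + 1) / ρ = 1)) := by
  have hs := sin_pi_div_pos P.three_le
  have hn : (0 : ℝ) < n := by have := P.three_le; positivity
  have hX := P.sum_cap_le hq
  have hY := P.sum_capPole_le hpos hmax
  set S := fun k => cross (q k) (sideVec n r (φ + δ) k) / 2 with hS
  set T := fun k => cross (capPole (sideVec n r (φ + δ) k) (q k)) (poleVec n z ρ φ k) / 2 with hT
  set t := fun k => Real.sqrt (inner ℝ (sideVec n r (φ + δ) k) (poleVec n z ρ φ k) / 4) with ht
  set X := ∑ k ∈ Finset.range n, S k with hXdef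
  set Y := ∑ k ∈ Finset.range n, T k with hYdef
  have hSpos : ∀ k, 0 < S k := fun k => half_pos (hpos k)
  have hTpos : ∀ k, 0 < T k := by
    intro k
    simp only [hT, cross_capPole]
    exact half_pos (mul_pos (inv_pos.2 (hpos k)) (P.inner_sideVec_poleVec_pos k))
  -- In fact an equality: the height of `q k` enters `S k` and `T k` reciprocally and cancels.
  have hST : ∀ k, t k ^ 2 ≤ S k * T k := by
    intro k
    simp only [ht, hS, hT, cross_capPole]
    rw [Real.sq_sqrt (div_nonneg (P.inner_sideVec_poleVec_pos k).le (by norm_num))]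
    have := (hpos k).ne'
    apply le_of_eq
    field_simp; norm_num
  have hcs : (∑ k ∈ Finset.range n, t k) ^ 2 ≤ X * Y :=
    Finset.sum_sq_le_sum_mul_sum_of_sq_le_mul _ (fun k _ => (hSpos k).le)
      (fun k _ => (hTpos k).le) fun k _ => hST k
  have hble : ∀ k ∈ Finset.range n, _ := fun k _ => (P.sqrt_cap_bound k).1
  have hsum := Finset.sum_le_sum hble
  rw [P.sum_bound] at hsum
  have hns : 0 < n * Real.sin (Real.pi / n) := by positivity
  have hsq : (n * Real.sin (Real.pi / n)) ^ 2 ≤ (∑ k ∈ Finset.range n, t k) ^ 2 :=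
    pow_le_pow_left₀ hns.le hsum 2
  have hne : (Finset.range n).Nonempty := Finset.nonempty_range_iff.2 (by
    have := P.three_le; omega)
  have hX0 : 0 < X := Finset.sum_pos (fun k _ => hSpos k) hne
  have hY0 : 0 < Y := Finset.sum_pos (fun k _ => hTpos k) hne
  have hprod : X * Y ≤ volumeProduct K := mul_le_mul hX hY hY0.le (hX0.le.trans hX)
  rw [← mul_pow]
  refine ⟨hsq.trans (hcs.trans hprod), fun heq => ?_⟩
  -- The whole chain collapses, and since X and Y are separately at most the two areas, each of them
  -- is attained.
  have hXY : volume.real K * volume.real (polarSet K) ≤ X * Y := by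
    have : volumeProduct K ≤ X * Y := heq.le.trans (hsq.trans hcs)
    exact this
  refine ⟨⟨le_antisymm hX ?_, le_antisymm hY ?_⟩, ?_⟩
  · refine le_of_mul_le_mul_right (hXY.trans ?_) (hY0.trans_le hY)
    exact mul_le_mul_of_nonneg_left hY hX0.le
  · refine le_of_mul_le_mul_left (hXY.trans ?_) (hX0.trans_le hX)
    exact mul_le_mul_of_nonneg_right hX hY0.le
  · have hsum' : ∑ k ∈ Finset.range n, t k ≤ n * Real.sin (Real.pi / n) :=
      le_of_sq_le_sq (hcs.trans (hprod.trans heq.le)) hns.le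
    have hall := (Finset.sum_eq_sum_iff_of_le hble).1
      (by rw [P.sum_bound]; exact le_antisymm hsum hsum')
    intro k hk
    exact (P.sqrt_cap_bound k).2 (hall k hk).ge

/-- The weights add up to 1, so one of them is nonzero. Its alternatives for k = 0, 1 make two
neighbouring side lines equidistant from `0` and `z`, so `z` is orthogonal to two independent
normals. -/
theorem center_eq_zero (P : BetweenPolygons n z ρ r φ δ K)
    (h : ∀ k ∈ Finset.range n, (weight n δ = 0 ∨ sideDist n z ρ φ k / ρ = 1) ∧
        (weight n (-δ) = 0 ∨ sideDist n z ρ φ (k + 1) / ρ = 1)) : z = 0 := by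
  have hρ := P.inradius_pos
  have hn := P.three_le
  have key : ∀ k, sideDist n z ρ φ k / ρ = 1 → inner ℝ (ray n φ k) z = inner ℝ (ray n φ k) 0 := by
    intro k hk
    rw [div_eq_one_iff_eq hρ.ne', sideDist] at hk
    rw [inner_zero_right, real_inner_comm]; linarith
  have hcr : ∀ k, cross (ray n φ k) (ray n φ (k + 1)) ≠ 0 := by
    intro k; rw [cross_ray_ray_succ]; exact (sin_two_pi_div_pos hn).ne'
  have m0 := h 0 (Finset.mem_range.2 (by omega))
  have m1 := h 1 (Finset.mem_range.2 (by omega))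
  by_cases hw : weight n δ = 0
  · have hw' : weight n (-δ) ≠ 0 := by
      intro h0; have := P.weight_add; rw [hw, h0] at this; norm_num at this
    exact eq_of_inner_eq (hcr 1) (key 1 (m0.2.resolve_left hw')) (key 2 (m1.2.resolve_left hw'))
  · exact eq_of_inner_eq (hcr 0) (key 0 (m0.1.resolve_left hw)) (key 1 (m1.1.resolve_left hw))

end BetweenPolygons

/-! ### The equality case. -/

theorem ray_mod {n : ℕ} (hn : 3 ≤ n) (A : ℝ) (k : ℕ) : ray n A (k % n) = ray n A k := by
  have h : ∀ m j : ℕ, ray n A (j + n * m) = ray n A j := by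
    intro m j
    induction m with
    | zero => simp
    | succ m ih => rw [Nat.mul_succ, ← add_assoc, ray_add_self hn, ih]
  rw [← h (k / n) (k % n), Nat.mod_add_div]

namespace BetweenPolygons

variable {n : ℕ} {z : Plane} {ρ r φ δ : ℝ} {K : Set Plane}

theorem sideDist_zero (n : ℕ) (ρ φ : ℝ) (k : ℕ) : sideDist n 0 ρ φ k = ρ := by
  simp [sideDist]

theorem inner_sideVec_poleVec_zero (P : BetweenPolygons n 0 ρ r φ δ K) (k : ℕ) :
    inner ℝ (sideVec n r (φ + δ) k) (poleVec n 0 ρ φ k) = 4 * Real.sin (Real.pi / n) ^ 2 := by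
  rw [P.inner_sideVec_poleVec, sideDist_zero, sideDist_zero, div_self P.inradius_pos.ne', div_one,
    div_one, P.weight_add, mul_one]

theorem cross_vertex (r A : ℝ) (k : ℕ) : cross (r • ray n A k) (r • ray n A (k + 1)) =
    r ^ 2 * Real.sin (2 * Real.pi / n) := by
  rw [cross_smul_left, cross_smul_right, cross_ray_ray_succ]; ring

theorem cross_vertex_sideVec (r A : ℝ) (k : ℕ) :
    cross (r • ray n A k) (sideVec n r A k) = r ^ 2 * Real.sin (2 * Real.pi / n) ∧
      cross (r • ray n A (k + 1)) (sideVec n r A k) = r ^ 2 * Real.sin (2 * Real.pi / n) := by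
  rw [sideVec, cross_sub_right, cross_sub_right, cross_self_eq_zero, cross_self_eq_zero,
    cross_swap (r • ray n A (k + 1)), cross_vertex]
  constructor <;> ring

/-- If equality holds and the `k`-th cap is non-degenerate, then small rotations of the support line
at the cap point `q k` are support lines. -/
theorem capPole_add_smul_mem (P : BetweenPolygons n 0 ρ r φ δ K) {q : ℕ → Plane}
    (hq : ∀ k, q k ∈ K) (hpos : ∀ k, 0 < cross (q k) (sideVec n r (φ + δ) k))
    (heq : ∑ k ∈ Finset.range n, cross (q k) (sideVec n r (φ + δ) k) / 2 = volume.real K)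
    {k : ℕ} (hk : k ∈ Finset.range n)
    (hbe : r ^ 2 * Real.sin (2 * Real.pi / n) < cross (q k) (sideVec n r (φ + δ) k)) :
    ∃ ε : ℝ, 0 < ε ∧ capPole (sideVec n r (φ + δ) k) (q k) + ε • perp (q k) ∈ polarSet K ∧
      capPole (sideVec n r (φ + δ) k) (q k) + (-ε) • perp (q k) ∈ polarSet K := by
  set g := sideVec n r (φ + δ) k with hg
  set κ := r ^ 2 * Real.sin (2 * Real.pi / n) with hκ
  -- Value of the functional `capPole g (q k)` on the chord. Up to the chord there is slack 1 - c,
  -- whence the size (1 - c)/B of the perturbation, `B` bounding the functional of `perp (q k)` on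
  -- `K`.
  set c := (cross (q k) g)⁻¹ * κ with hc
  have hc1 : c < 1 := by
    rw [hc, inv_mul_lt_one₀ (hpos k)]; exact hbe
  obtain ⟨M, hM⟩ := P.body.isCompact.isBounded.exists_norm_le
  have hB : ∀ x ∈ K, |inner ℝ (perp (q k)) x| ≤ ‖perp (q k)‖ * M + 1 := by
    intro x hx
    have h1 := abs_real_inner_le_norm (perp (q k)) x
    have h2 := mul_le_mul_of_nonneg_left (hM x hx) (norm_nonneg (perp (q k)))
    linarith
  have hM0 : 0 ≤ M := (norm_nonneg _).trans (hM _ (hq k))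
  have hBpos : 0 < ‖perp (q k)‖ * M + 1 := by positivity
  set B := ‖perp (q k)‖ * M + 1
  have hsmall : ∀ η : ℝ, |η| = (1 - c) / B →
      capPole g (q k) + η • perp (q k) ∈ polarSet K := by
    intro η hη
    have hlow : ∀ x ∈ K, cross x g ≤ κ → inner ℝ (capPole g (q k) + η • perp (q k)) x ≤ 1 := by
      intro x hx hxg
      rw [inner_add_left, inner_smul_left, inner_capPole]
      have h1 : (cross (q k) g)⁻¹ * cross x g ≤ c :=
        mul_le_mul_of_nonneg_left hxg (inv_pos.2 (hpos k)).le
      have h2 : η * inner ℝ (perp (q k)) x ≤ 1 - c := by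
        refine (le_abs_self _).trans ?_
        rw [abs_mul, hη]
        calc (1 - c) / B * |inner ℝ (perp (q k)) x| ≤ (1 - c) / B * B :=
              mul_le_mul_of_nonneg_left (hB x hx) (div_nonneg (by linarith) hBpos.le)
          _ = 1 - c := by field_simp
      simp only [conj_trivial]; linarith
    intro x hx
    rcases le_or_gt (cross x g) κ with hle | hgt
    · exact hlow x hx hle
    · have hv : ∀ k, r • ray n (φ + δ) k ∈ K := fun k => by simpa using P.vertex_mem k
      have hx' : x ∈ (fun v => v + (0 : Plane)) ⁻¹' K := by simpa using hx
      -- Beyond the chord, equality makes the cap a triangle. The perturbed functional is at most 1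
      -- at the two ends of the chord and still equal to 1 at `q k`, because ⟨perp q, q⟩ = 0.
      obtain ⟨α, β, γ, hα, hβ, hγ, hsum, hxe⟩ := P.fan_body.inTriangle_of_eq P.three_le
        (c := q) (fun k _ => by simpa using hq k)
        (by rw [volume_translate]; exact heq) hk hx' (by rw [cross_vertex]; exact hgt)
      have h1 := hlow _ (hv k) (cross_vertex_sideVec r (φ + δ) k).1.le
      have h2 := hlow _ (hv (k + 1)) (cross_vertex_sideVec r (φ + δ) k).2.le
      have h3 : inner ℝ (capPole g (q k) + η • perp (q k)) (q k) = 1 := by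
        rw [inner_add_left, inner_smul_left, inner_capPole, inner_perp_left, cross_self_eq_zero,
          inv_mul_cancel₀ (hpos k).ne']
        simp
      rw [hxe, inner_add_right, inner_add_right, inner_smul_right _ _ α, inner_smul_right _ _ β,
        inner_smul_right _ _ γ, h3]
      have := mul_le_mul_of_nonneg_left h1 hα
      have := mul_le_mul_of_nonneg_left h2 hγ
      linarith
  have hε : 0 < (1 - c) / B := div_pos (by linarith) hBpos
  exact ⟨_, hε, hsmall _ (abs_of_pos hε), hsmall _ (by rw [abs_neg, abs_of_pos hε])⟩

/-- The pole of the support line at `q k` is the midpoint of a segment in the polar body, in the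
direction `perp (q k)`, and it maximises the linear functional of the `k`-th polar cap. That
functional is therefore constant on the segment, so `q k` has the same inner product with both
poles. If this product were below 1, the polar cap would be a triangle in which only the apex has
product 1 with `q k`, contradicting the segment. -/
theorem inner_cap_eq_one (P : BetweenPolygons n 0 ρ r φ δ K) {q : ℕ → Plane}
    (hq : ∀ k, q k ∈ K) (hpos : ∀ k, 0 < cross (q k) (sideVec n r (φ + δ) k))
    (hmax : ∀ k, ∀ x ∈ K, cross x (sideVec n r (φ + δ) k) ≤
      cross (q k) (sideVec n r (φ + δ) k))
    (heq : ∑ k ∈ Finset.range n, cross (q k) (sideVec n r (φ + δ) k) / 2 = volume.real K)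
    (heq' : ∑ k ∈ Finset.range n,
      cross (capPole (sideVec n r (φ + δ) k) (q k)) (poleVec n 0 ρ φ k) / 2 =
        volume.real (polarSet K))
    {k : ℕ} (hk : k ∈ Finset.range n)
    (hbe : r ^ 2 * Real.sin (2 * Real.pi / n) < cross (q k) (sideVec n r (φ + δ) k)) :
    inner ℝ (q k) (sidePole n 0 ρ φ k) = 1 ∧ inner ℝ (q k) (sidePole n 0 ρ φ (k + 1)) = 1 := by
  obtain ⟨ε, hε, hmem1, hmem2⟩ := P.capPole_add_smul_mem hq hpos heq hk hbe
  set g := sideVec n r (φ + δ) k with hg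
  set w := capPole g (q k) with hw
  set y := sidePole n 0 ρ φ k with hy
  set y' := sidePole n 0 ρ φ (k + 1) with hy'
  have hc : ∀ k ∈ Finset.range n, capPole (sideVec n r (φ + δ) k) (q k) ∈ polarSet K :=
    fun k _ => capPole_mem (hpos k) (hmax k)
  have hle := fun {d : Plane} (hd : d ∈ polarSet K) =>
    P.fan_polar.cross_le_of_eq P.three_le hc heq' hk hd
  have hwq : inner ℝ w (q k) = 1 := by
    rw [hw, inner_capPole, inv_mul_cancel₀ (hpos k).ne']
  have h1 := hle hmem1
  have h2 := hle hmem2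
  rw [cross_add_left, cross_smul_left, cross_perp_left] at h1 h2
  have h0 : inner ℝ (q k) (y' - y) = 0 := by
    have a1 : ε * inner ℝ (q k) (y' - y) ≤ 0 := by linarith
    have a2 : 0 ≤ ε * inner ℝ (q k) (y' - y) := by linarith
    rcases mul_eq_zero.1 (le_antisymm a1 a2) with h | h
    · exact absurd h hε.ne'
    · exact h
  have heqs : inner ℝ (q k) y' = inner ℝ (q k) y := by
    rw [inner_sub_right] at h0; linarith
  have hs1 : inner ℝ (q k) y ≤ 1 := by
    rw [real_inner_comm]; exact P.sidePole_mem k _ (hq k)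
  suffices hs : inner ℝ (q k) y = 1 from ⟨hs, heqs.trans hs⟩
  by_contra hne
  have hlt : inner ℝ (q k) y < 1 := lt_of_le_of_ne hs1 hne
  have hyy := P.fan_polar.cross_pos P.three_le k
  have hge : cross y y' ≤ cross w (y' - y) := by
    have := hle (P.sidePole_mem k)
    rwa [cross_sub_right, cross_self_eq_zero, sub_zero] at this
  -- On the chord of poles, ⟨q k, ·⟩ has the constant value ⟨q k, y⟩ < 1, but it equals 1 at `w`. So
  -- `w` must be strictly beyond the chord and the cap is a triangle.
  rcases hge.eq_or_lt with hon | hbeyond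
  · have hcomb := eq_cross_combination hyy.ne' w
    have h3 := congrArg (fun v => inner ℝ (q k) v) hcomb
    simp only [inner_add_right, inner_smul_right] at h3
    rw [real_inner_comm, hwq, heqs, ← add_mul, ← add_div] at h3
    rw [cross_sub_right, cross_swap w y] at hon
    rw [show cross w y' + cross y w = cross y y' by linarith, div_self hyy.ne', one_mul] at h3
    exact hne h3.symm
  · have hz : cross (w + ε • perp (q k)) (y' - y) = cross w (y' - y) := by
      rw [cross_add_left, cross_smul_left, cross_perp_left, h0, mul_zero, add_zero]
    obtain ⟨α, β, γ, hα, hβ, hγ, hsum, he⟩ := P.fan_polar.inTriangle_of_eq P.three_le hc heq' hk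
      hmem1 (by rw [← hy, ← hy', hz]; exact hbeyond)
    have h3 := congrArg (fun v => inner ℝ (q k) v) he
    have hwq' : inner ℝ (q k) w = 1 := by rw [real_inner_comm]; exact hwq
    have hperp : inner ℝ (q k) (perp (q k)) = 0 := by
      rw [real_inner_comm, inner_perp_left, cross_self_eq_zero]
    simp only [inner_add_right, inner_smul_right] at h3
    rw [← hg, ← hw, ← hy, ← hy', hwq', hperp, heqs] at h3
    have hαγ : (α + γ) * (1 - inner ℝ (q k) y) = 0 := by
      have : β = 1 - α - γ := by linarith
      rw [this] at h3; linarith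
    have hαγ0 : α + γ = 0 := by
      rcases mul_eq_zero.1 hαγ with h | h
      · exact h
      · linarith
    have hα0 : α = 0 := by linarith
    have hγ0 : γ = 0 := by linarith
    have hβ1 : β = 1 := by linarith
    rw [hα0, hγ0, hβ1, ← hg, ← hw, zero_smul, zero_smul, one_smul, zero_add, add_zero,
      add_eq_left, smul_eq_zero] at he
    have hp0 := he.resolve_left hε.ne'
    have hq0 : q k = 0 := by
      have e0 := congrArg (fun v : Plane => v 1) hp0
      have e1 := congrArg (fun v : Plane => v 0) hp0
      simp only [perp, Matrix.cons_val, PiLp.zero_apply, neg_eq_zero] at e0 e1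
      exact plane_ext e0 e1
    rw [hq0, inner_zero_right] at hwq
    exact zero_ne_one hwq

/-- The corner of the outer polygon between two consecutive sides is determined by the poles. -/
theorem eq_corner (P : BetweenPolygons n 0 ρ r φ δ K) {x : Plane} {k : ℕ}
    (h1 : inner ℝ x (sidePole n 0 ρ φ k) = 1) (h2 : inner ℝ x (sidePole n 0 ρ φ (k + 1)) = 1) :
    x = (ρ / Real.cos (Real.pi / n)) • ray n (φ - Real.pi / n) (k + 1) := by
  have hρ := P.inradius_pos
  have hc := cos_pi_div_pos P.three_le
  have hcr : cross (ray n φ k) (ray n φ (k + 1)) ≠ 0 := by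
    rw [cross_ray_ray_succ]; exact (sin_two_pi_div_pos P.three_le).ne'
  rw [sidePole, sideDist_zero, inner_smul_right, real_inner_comm] at h1 h2
  have e1 : inner ℝ (ray n φ k) x = ρ := by field_simp at h1; exact h1
  have e2 : inner ℝ (ray n φ (k + 1)) x = ρ := by field_simp at h2; exact h2
  refine eq_of_inner_eq hcr ?_ ?_
  · rw [e1, inner_smul_right, inner_ray_ray,
      show φ - (φ - Real.pi / n) + (((k : ℕ) - (k + 1 : ℕ) : ℤ) : ℝ) * (2 * Real.pi / n) =
        -(Real.pi / n) by push_cast; ring, Real.cos_neg]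
    field_simp
  · rw [e2, inner_smul_right, inner_ray_ray,
      show φ - (φ - Real.pi / n) + (((k + 1 : ℕ) - (k + 1 : ℕ) : ℤ) : ℝ) * (2 * Real.pi / n) =
        Real.pi / n by push_cast; ring]
    field_simp

/-- With the centre at the origin the products of paired cap areas all equal sin²(π/n), so equality
in Cauchy–Schwarz makes the cap areas of `K` constant. Hence the caps are either all degenerate or
all have a corner of the outer polygon as apex. -/
theorem subset_inner_or_outer_subset (P : BetweenPolygons n 0 ρ r φ δ K) {q : ℕ → Plane}
    (hq : ∀ k, q k ∈ K) (hpos : ∀ k, 0 < cross (q k) (sideVec n r (φ + δ) k))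
    (hmax : ∀ k, ∀ x ∈ K, cross x (sideVec n r (φ + δ) k) ≤
      cross (q k) (sideVec n r (φ + δ) k))
    (heq : ∑ k ∈ Finset.range n, cross (q k) (sideVec n r (φ + δ) k) / 2 = volume.real K)
    (heq' : ∑ k ∈ Finset.range n,
      cross (capPole (sideVec n r (φ + δ) k) (q k)) (poleVec n 0 ρ φ k) / 2 =
        volume.real (polarSet K))
    (hvol : volumeProduct K = (n : ℝ) ^ 2 * Real.sin (Real.pi / n) ^ 2) :
    K ⊆ regularPolygon n 0 r (φ + δ) ∨
      regularPolygon n 0 (ρ / Real.cos (Real.pi / n)) (φ - Real.pi / n) ⊆ K := by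
  have hn := P.three_le
  have hs := sin_pi_div_pos hn
  have hr := P.circumradius_pos
  have hconst := eq_of_sum_mul_sum_inv hs
    (S := fun k => cross (q k) (sideVec n r (φ + δ) k) / 2) (fun k _ => half_pos (hpos k)) (by
      have hT : ∀ k ∈ Finset.range n,
          Real.sin (Real.pi / n) ^ 2 / (cross (q k) (sideVec n r (φ + δ) k) / 2) =
          cross (capPole (sideVec n r (φ + δ) k) (q k)) (poleVec n 0 ρ φ k) / 2 := by
        intro k _
        have := (hpos k).ne'
        rw [cross_capPole, P.inner_sideVec_poleVec_zero]; field_simp; norm_num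
      rw [Finset.sum_congr rfl hT, heq, heq', mul_pow]; exact hvol)
  set m := (∑ k ∈ Finset.range n, cross (q k) (sideVec n r (φ + δ) k) / 2) / n
  rcases le_or_gt (2 * m) (r ^ 2 * Real.sin (2 * Real.pi / n)) with hle | hgt
  · left
    intro x hx
    refine mem_regularPolygon_of_inner_le hn hr fun k hk => ?_
    have h1 := hmax k x hx
    have h2 := hconst k (Finset.mem_range.2 hk)
    have h3 : cross x (sideVec n r (φ + δ) k) ≤ r ^ 2 * Real.sin (2 * Real.pi / n) := by
      linarith
    rw [cross_sideVec, sin_two_pi_div] at h3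
    rw [sub_zero]
    refine le_of_mul_le_mul_left (a := r * (2 * Real.sin (Real.pi / n))) ?_ (by positivity)
    linarith
  · right
    have hcorner : ∀ k < n,
        (ρ / Real.cos (Real.pi / n)) • ray n (φ - Real.pi / n) (k + 1) ∈ K := by
      intro k hk
      have h2 := hconst k (Finset.mem_range.2 hk)
      obtain ⟨e1, e2⟩ := P.inner_cap_eq_one hq hpos hmax heq heq' (Finset.mem_range.2 hk)
        (by linarith)
      rw [← P.eq_corner e1 e2]; exact hq k
    refine convexHull_min ?_ P.body.convex
    rintro _ ⟨j, rfl⟩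
    rw [regularVertex_eq, zero_add]
    -- The `k`-th cap yields the corner of index `k + 1`, so the corner `j` comes from the
    -- predecessor of `j` modulo `n`.
    have := hcorner ((j + n - 1) % n) (Nat.mod_lt _ (by omega))
    rwa [← ray_mod hn, Nat.mod_add_mod, show j + n - 1 + 1 = j + n by omega, ray_mod hn,
      ray_add_self hn] at this

/-- The area bound for convex bodies between two concentric regular polygons. -/
theorem volumeProduct_ge_and_eq (P : BetweenPolygons n z ρ r φ δ K) :
    (n : ℝ) ^ 2 * Real.sin (Real.pi / n) ^ 2 ≤ volumeProduct K ∧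
    (volumeProduct K = (n : ℝ) ^ 2 * Real.sin (Real.pi / n) ^ 2 →
      z = 0 ∧ (K ⊆ regularPolygon n z r (φ + δ) ∨
      regularPolygon n z (ρ / Real.cos (Real.pi / n)) (φ - Real.pi / n) ⊆ K)) := by
  obtain ⟨q, hq⟩ := P.exists_cap_points
  have h := P.volumeProduct_bound (fun k => (hq k).1) (fun k => (hq k).2.1) (fun k => (hq k).2.2)
  refine ⟨h.1, fun hvol => ?_⟩
  obtain ⟨⟨heq, heq'⟩, hw⟩ := h.2 hvol
  obtain rfl := P.center_eq_zero hw
  exact ⟨rfl, P.subset_inner_or_outer_subset (fun k => (hq k).1) (fun k => (hq k).2.1)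
    (fun k => (hq k).2.2) heq heq' hvol⟩

end BetweenPolygons

/-! ### The common centre of the two polygons. -/

theorem ray_eq_of_modEq {n : ℕ} (hn : 3 ≤ n) (A : ℝ) {j k : ℕ}
    (h : (j : ℤ) ≡ k [ZMOD n]) : ray n A j = ray n A k := by
  have h' : j % n = k % n := Int.natCast_modEq_iff.1 h
  rw [← ray_mod hn A j, h', ray_mod hn]

theorem exists_nat_modEq {n : ℕ} (hn : 3 ≤ n) (i : ℤ) : ∃ j : ℕ, (j : ℤ) ≡ i [ZMOD n] := by
  refine ⟨(i % n).toNat, ?_⟩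
  rw [Int.toNat_of_nonneg (Int.emod_nonneg _ (by omega))]
  exact Int.mod_modEq _ _

theorem ray_add_int_mul {n : ℕ} (hn : 3 ≤ n) (A : ℝ) (m : ℤ) (k : ℕ) :
    ∃ j : ℕ, ray n (A + m * (2 * Real.pi / n)) k = ray n A j := by
  have hn0 : (n : ℝ) ≠ 0 := by positivity
  obtain ⟨j, hj⟩ := exists_nat_modEq hn (k + m)
  obtain ⟨q, hq⟩ := hj.dvd
  refine ⟨j, ?_⟩
  have hq' : (k : ℝ) + m - j = n * q := by exact_mod_cast hq
  rw [ray, ray, ← dir_add_int_mul_two_pi (A + 2 * Real.pi * j / n) q]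
  congr 1
  have : (m : ℝ) = n * q + j - k := by linarith
  rw [this]; field_simp; ring

theorem regularPolygon_add_int_mul {n : ℕ} (hn : 3 ≤ n) (z : Plane) (r A : ℝ) (m : ℤ) :
    regularPolygon n z r (A + m * (2 * Real.pi / n)) = regularPolygon n z r A := by
  have h : ∀ (A : ℝ) (m : ℤ), regularPolygon n z r (A + m * (2 * Real.pi / n)) ⊆
      regularPolygon n z r A := by
    intro A m
    refine convexHull_min ?_ (convex_convexHull ℝ _)
    rintro _ ⟨k, rfl⟩
    obtain ⟨j, hj⟩ := ray_add_int_mul hn A m k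
    rw [regularVertex_eq, hj]
    exact regularVertex_mem n z r A j
  refine (h A m).antisymm ?_
  have := h (A + m * (2 * Real.pi / n)) (-m)
  rwa [Int.cast_neg, neg_mul, add_neg_cancel_right] at this

theorem inner_eq_of_mem_regularSide {n : ℕ} {z x : Plane} {r θ : ℝ} {k : ℕ}
    (hx : x ∈ regularSide n z r θ k) :
    inner ℝ (x - z) (ray n (θ + Real.pi / n) k) = r * Real.cos (Real.pi / n) := by
  obtain ⟨s, t, _, _, hst, rfl⟩ := hx
  rw [regularVertex_eq, regularVertex_eq]
  have e : s • (z + r • ray n θ k) + t • (z + r • ray n θ (k + 1)) - z =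
      (s * r) • ray n θ k + (t * r) • ray n θ (k + 1) := by
    obtain rfl : s = 1 - t := by linarith
    module
  have e1 : inner ℝ (ray n θ k) (ray n (θ + Real.pi / n) k) = Real.cos (Real.pi / n) := by
    rw [inner_ray_ray, ← Real.cos_neg (Real.pi / n)]; congr 1; push_cast; ring
  have e2 : inner ℝ (ray n θ (k + 1)) (ray n (θ + Real.pi / n) k) = Real.cos (Real.pi / n) := by
    rw [inner_ray_ray]; congr 1; push_cast; ring
  rw [e, inner_add_left, inner_smul_left, inner_smul_left, e1, e2]
  simp only [conj_trivial]
  rw [← add_mul, ← add_mul, hst, one_mul]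

theorem regularSide_subset (n : ℕ) (z : Plane) (r θ : ℝ) (k : ℕ) :
    regularSide n z r θ k ⊆ regularPolygon n z r θ :=
  (convex_convexHull ℝ _).segment_subset (regularVertex_mem n z r θ k)
    (regularVertex_mem n z r θ (k + 1))

theorem inner_ray_recurrence (n : ℕ) (A : ℝ) (d : Plane) (k : ℕ) :
    inner ℝ d (ray n A (k + 2)) + inner ℝ d (ray n A k) =
      2 * Real.cos (2 * Real.pi / n) * inner ℝ d (ray n A (k + 1)) := by
  have key : ∀ M p : ℝ, inner ℝ d (dir (M + p)) + inner ℝ d (dir (M - p)) =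
      2 * Real.cos p * inner ℝ d (dir M) := by
    intro M p
    simp only [inner_plane, dir, Matrix.cons_val, Real.sin_add, Real.sin_sub, Real.cos_add,
      Real.cos_sub]
    ring
  unfold ray
  rw [← key]
  congr 3 <;> (push_cast; ring)

/-- Write f_k for the inner products; their sum is zero, so c ≥ 0. If f_{k+1} < c, both neighbours
equal c and the recurrence reads c = cos(2π/n) f_{k+1}. For n ≥ 4 the cosine is nonnegative: f_{k+1}
≥ 0 would give c ≤ f_{k+1}, and f_{k+1} < 0 gives c = 0 and then f_{k+3} = -f_{k+1} > c. So all f_k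
equal c, which vanishes by averaging. The cosine is negative for n = 3, where the extra hypothesis
is used. -/
theorem eq_zero_of_inner_ray_le {n : ℕ} (hn : 3 ≤ n) {A c : ℝ} {d : Plane}
    (hle : ∀ k, inner ℝ d (ray n A k) ≤ c)
    (halt : ∀ k, inner ℝ d (ray n A (k + 1)) = c ∨ inner ℝ d (ray n A k) = c)
    (hthree : n = 3 → ∀ k, inner ℝ d (ray n A k) = c) : d = 0 ∧ c = 0 := by
  have hn0 : (0 : ℝ) < n := by positivity
  have hc0 : 0 ≤ c := by
    have h := Finset.sum_le_sum fun k (_ : k ∈ Finset.range n) => hle k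
    rw [sum_inner_ray hn, Finset.sum_const, Finset.card_range, nsmul_eq_mul] at h
    exact nonneg_of_mul_nonneg_right h hn0
  have hall : ∀ k, inner ℝ d (ray n A (k + 1)) = c := by
    rcases hn.eq_or_lt with h3 | h4
    · exact fun k => hthree h3.symm _
    · intro k
      by_contra hne
      have hlt := lt_of_le_of_ne (hle (k + 1)) hne
      have e0 := (halt k).resolve_left hne
      have e2 := (halt (k + 1)).resolve_right hne
      have r1 := inner_ray_recurrence n A d k
      have r2 := inner_ray_recurrence n A d (k + 1)
      rw [show k + 1 + 1 = k + 2 by ring] at e2 r2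
      rw [e0, e2] at r1
      rw [e2] at r2
      have hN4 : 2 * Real.pi / n ≤ Real.pi / 2 := by
        have : (4 : ℝ) ≤ n := by exact_mod_cast h4
        rw [div_le_div_iff₀ hn0 two_pos]; nlinarith [Real.pi_pos]
      have hNpos : 0 < 2 * Real.pi / n := by positivity
      have hcos : 0 ≤ Real.cos (2 * Real.pi / n) :=
        Real.cos_nonneg_of_mem_Icc ⟨by linarith [Real.pi_pos], hN4⟩
      have hcos1 := Real.cos_le_one (2 * Real.pi / n)
      set f := inner ℝ d (ray n A (k + 1))
      have hle3 := hle (k + 1 + 2)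
      rcases le_or_gt 0 f with hf | hf
      · nlinarith
      · have hc : c = 0 := by nlinarith
        rw [hc] at r2 hle3
        linarith
  have hc : c = 0 := by
    have h := sum_inner_ray hn (A + 2 * Real.pi / n) d
    have hshift : ∀ k, ray n (A + 2 * Real.pi / n) k = ray n A (k + 1) := by
      intro k; rw [ray_succ_eq, ray_shift]
    simp only [hshift, hall, Finset.sum_const, Finset.card_range, nsmul_eq_mul] at h
    exact (mul_eq_zero.1 h).resolve_left hn0.ne'
  refine ⟨?_, hc⟩
  have hcr : cross (ray n A 1) (ray n A 2) ≠ 0 := by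
    rw [cross_ray_ray_succ n A 1]; exact (sin_two_pi_div_pos hn).ne'
  refine eq_of_inner_eq hcr ?_ ?_
  · rw [inner_zero_right, real_inner_comm, hall 0, hc]
  · rw [inner_zero_right, real_inner_comm, hall 1, hc]

/-- Two regular `n`-gons such that the vertices of the first lie on the sides of the second are
concentric. -/
theorem concentric_of_vertices_mem_sides {n : ℕ} (hn : 3 ≤ n) {zi zo : Plane} {ri ro θi θo : ℝ}
    (hri : 0 < ri) (hro : 0 < ro)
    (hv : ∀ j : ℕ, ∃ k : ℕ, regularVertex n zi ri θi j ∈ regularSide n zo ro θo k)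
    (hthree : n = 3 → ∀ k : ℕ, ∃ j : ℕ, regularVertex n zi ri θi j ∈ regularSide n zo ro θo k) :
    zi = zo ∧ ∃ (δ : ℝ) (m : ℤ), -(Real.pi / n) ≤ δ ∧ δ ≤ Real.pi / n ∧
      ri * Real.cos δ = ro * Real.cos (Real.pi / n) ∧
      θi = θo + Real.pi / n + δ + m * (2 * Real.pi / n) := by
  have hn0 : (0 : ℝ) < n := by positivity
  set N := 2 * Real.pi / n with hN
  have hNpos : 0 < N := by have := Real.pi_pos; positivity
  have hhalf : Real.pi / n = N / 2 := by rw [hN]; ring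
  set φ := θo + Real.pi / n with hφ
  -- Rounding to the nearest multiple of `N` puts δ in [-π/n, π/n).
  set m := ⌊(θi - φ) / N + 1 / 2⌋ with hm
  set δ := θi - φ - m * N with hδ
  have hδ1 : -(Real.pi / n) ≤ δ := by
    have h := Int.floor_le ((θi - φ) / N + 1 / 2)
    rw [← hm] at h
    have h2 := mul_le_mul_of_nonneg_right h hNpos.le
    rw [add_mul, div_mul_cancel₀ _ hNpos.ne'] at h2
    rw [hhalf]; linarith
  have hδ2 : δ < Real.pi / n := by
    have h := Int.lt_floor_add_one ((θi - φ) / N + 1 / 2)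
    rw [← hm] at h
    have h2 := mul_lt_mul_of_pos_right h hNpos
    rw [add_mul, div_mul_cancel₀ _ hNpos.ne'] at h2
    rw [hhalf]; linarith
  set d := zi - zo with hd
  set ρ := ro * Real.cos (Real.pi / n) with hρ
  have hinner : ∀ j k : ℕ, inner ℝ (regularVertex n zi ri θi j - zo) (ray n φ k) =
      inner ℝ d (ray n φ k) + ri * Real.cos (δ + ((j - k + m : ℤ) : ℝ) * N) := by
    intro j k
    rw [regularVertex_eq, show zi + ri • ray n θi j - zo = d + ri • ray n θi j by rw [hd]; abel,
      inner_add_left, inner_smul_left, inner_ray_ray]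
    simp only [conj_trivial]
    congr 3
    rw [hδ]; push_cast; ring
  have hle0 : ∀ j k : ℕ, inner ℝ d (ray n φ k) + ri * Real.cos (δ + ((j - k + m : ℤ) : ℝ) * N) ≤
      ρ := by
    intro j k
    rw [← hinner]
    obtain ⟨k', hk'⟩ := hv j
    exact inner_le_of_mem_regularPolygon hn hro.le (regularSide_subset _ _ _ _ _ hk') k
  -- Each side has a vertex at angle δ from its normal, which lies in its half-plane; this bounds
  -- ⟨d, u_k⟩ by c. A vertex on the side `k` forces equality.
  set c := ρ - ri * Real.cos δ with hc
  have hle : ∀ k, inner ℝ d (ray n φ k) ≤ c := by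
    intro k
    obtain ⟨j, hj⟩ := exists_nat_modEq hn (k - m)
    have h := hle0 j k
    rw [hN, cos_add_int_mul_eq_emod hn, show ((j : ℤ) - k + m) % n = 0 by
      have := hj.add_right (-k + m : ℤ)
      rw [show (k : ℤ) - m + (-k + m) = 0 by ring, ← add_assoc, ← sub_eq_add_neg] at this
      simpa [Int.ModEq] using this] at h
    rw [Int.cast_zero, zero_mul, add_zero] at h
    linarith
  have hge : ∀ j k : ℕ, regularVertex n zi ri θi j ∈ regularSide n zo ro θo k →
      c ≤ inner ℝ d (ray n φ k) ∧ Real.cos δ ≤ Real.cos (δ + ((j - k + m : ℤ) : ℝ) * N) := by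
    intro j k hjk
    have h := inner_eq_of_mem_regularSide hjk
    rw [← hφ, hinner] at h
    have h1 := cos_add_int_mul_le hn hδ1 hδ2.le (j - k + m)
    have h2 := mul_le_mul_of_nonneg_left h1 hri.le
    refine ⟨by rw [← hN] at h2; linarith, ?_⟩
    have h3 := hle k
    exact le_of_mul_le_mul_left (by linarith) hri
  -- The vertex at angle δ from the normal `k + 1` lies on some side, which by the cosine comparison
  -- is the side `k + 1` or, in case of a tie, the side `k`.
  have halt : ∀ k, inner ℝ d (ray n φ (k + 1)) = c ∨ inner ℝ d (ray n φ k) = c := by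
    intro k
    obtain ⟨j, hj⟩ := exists_nat_modEq hn (k + 1 - m)
    obtain ⟨k', hk'⟩ := hv j
    obtain ⟨h1, h2⟩ := hge j k' hk'
    have h3 : inner ℝ d (ray n φ k') = c := le_antisymm (hle k') h1
    have hj' : (j : ℤ) - k' + m ≡ k + 1 - k' [ZMOD n] := by
      have := hj.add_right (-k' + m : ℤ)
      convert this using 1 <;> ring
    rcases eq_of_cos_le_cos_add_int_mul hn hδ1 hδ2 _ h2 with h | h
    · left
      rw [← h3, ray_eq_of_modEq hn φ (j := k + 1) (k := k')]
      have h0 : (k : ℤ) + 1 - k' ≡ 0 [ZMOD n] := hj'.symm.trans (by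
        rw [Int.ModEq, h]; simp)
      have := h0.add_right (k' : ℤ)
      push_cast
      convert this using 1 <;> ring
    · right
      rw [← h3, ray_eq_of_modEq hn φ (j := k) (k := k')]
      have h0 : (k : ℤ) + 1 - k' ≡ 1 [ZMOD n] := hj'.symm.trans (by
        rw [Int.ModEq, h, Int.emod_eq_of_lt (by norm_num) (by omega)])
      have := h0.add_right (k' - 1 : ℤ)
      convert this using 1 <;> ring
  obtain ⟨h0, hc0⟩ := eq_zero_of_inner_ray_le hn hle halt fun h3 k => by
    obtain ⟨j, hj⟩ := hthree h3 k
    exact le_antisymm (hle k) (hge j k hj).1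
  exact ⟨sub_eq_zero.1 h0, δ, m, hδ1, hδ2.le, by linarith, by rw [hδ]; ring⟩

/-- The volume product of a convex body between two regular polygons. -/
theorem volumeProduct_between_regularPolygons {n : ℕ} (hn : 3 ≤ n) {z : Plane}
    {ri ro θi θo δ : ℝ} {m : ℤ} (hri : 0 < ri) (hro : 0 < ro)
    (hδ1 : -(Real.pi / n) ≤ δ) (hδ2 : δ ≤ Real.pi / n)
    (hrad : ri * Real.cos δ = ro * Real.cos (Real.pi / n))
    (hθ : θi = θo + Real.pi / n + δ + m * (2 * Real.pi / n)) {K : Set Plane}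
    (hK : IsConvexBodyAroundOrigin K) (hi : regularPolygon n z ri θi ⊆ K)
    (ho : K ⊆ regularPolygon n z ro θo) :
    (n : ℝ) ^ 2 * Real.sin (Real.pi / n) ^ 2 ≤ volumeProduct K ∧
      (volumeProduct K = (n : ℝ) ^ 2 * Real.sin (Real.pi / n) ^ 2 ↔
        z = 0 ∧ (K = regularPolygon n z ri θi ∨ K = regularPolygon n z ro θo)) := by
  have hc := cos_pi_div_pos hn
  have hpoly : regularPolygon n z ri θi = regularPolygon n z ri (θo + Real.pi / n + δ) := by
    rw [hθ, regularPolygon_add_int_mul hn]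
  have P : BetweenPolygons n z (ro * Real.cos (Real.pi / n)) ri (θo + Real.pi / n) δ K :=
    { three_le := hn
      body := hK
      inradius_pos := by positivity
      circumradius_pos := hri
      neg_le := hδ1
      le := hδ2
      radii := hrad
      vertex_mem := fun k => hi (by rw [hpoly]; exact regularVertex_mem _ _ _ _ k)
      inner_le := fun x hx k => inner_le_of_mem_regularPolygon hn hro.le (ho hx) k }
  obtain ⟨h1, h2⟩ := P.volumeProduct_ge_and_eq
  rw [← hpoly, mul_div_cancel_right₀ _ hc.ne', add_sub_cancel_right] at h2
  refine ⟨h1, fun heq => ?_, ?_⟩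
  · obtain ⟨hz, h | h⟩ := h2 heq
    · exact ⟨hz, Or.inl (h.antisymm hi)⟩
    · exact ⟨hz, Or.inr (ho.antisymm h)⟩
  · rintro ⟨rfl, rfl | rfl⟩
    · exact le_antisymm (volumeProduct_regularPolygon_le hn hri) h1
    · exact le_antisymm (volumeProduct_regularPolygon_le hn hro) h1

/-! ### Linear invariance -/

/-- The linear map of the plane with the given matrix. -/
noncomputable def planeMap (M : Matrix (Fin 2) (Fin 2) ℝ) : Plane →ₗ[ℝ] Plane :=
  Matrix.toLin (EuclideanSpace.basisFun (Fin 2) ℝ).toBasis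
    (EuclideanSpace.basisFun (Fin 2) ℝ).toBasis M

theorem planeMap_apply (M : Matrix (Fin 2) (Fin 2) ℝ) (x : Plane) (i : Fin 2) :
    planeMap M x i = M i 0 * x 0 + M i 1 * x 1 := by
  simp [planeMap, Matrix.toLin_apply, Matrix.mulVec, Fin.sum_univ_two, dotProduct]
  fin_cases i <;> simp

theorem det_planeMap (M : Matrix (Fin 2) (Fin 2) ℝ) : LinearMap.det (planeMap M) = M.det := by
  simp [planeMap]

theorem cross_planeMap (M : Matrix (Fin 2) (Fin 2) ℝ) (x y : Plane) :
    cross (planeMap M x) (planeMap M y) = M.det * cross x y := by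
  simp only [cross, planeMap_apply, Matrix.det_fin_two]; ring

theorem polarSet_image_planeMap (M : Matrix (Fin 2) (Fin 2) ℝ) (K : Set Plane) :
    polarSet (planeMap M '' K) = planeMap M.transpose ⁻¹' polarSet K := by
  ext x
  have h : ∀ y, inner ℝ x (planeMap M y) = inner ℝ (planeMap M.transpose x) y := by
    intro y; simp only [inner_plane, planeMap_apply, Matrix.transpose_apply]; ring
  simp [polarSet, h]

theorem volumeProduct_image_planeMap {M : Matrix (Fin 2) (Fin 2) ℝ} (hM : M.det ≠ 0)
    (K : Set Plane) : volumeProduct (planeMap M '' K) = volumeProduct K := by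
  have hM' : |M.det| ≠ 0 := abs_ne_zero.2 hM
  unfold volumeProduct
  -- The area of the body is multiplied by |det M| and that of the polar by its inverse.
  rw [polarSet_image_planeMap, Measure.real, Measure.real, Measure.addHaar_image_linearMap,
    Measure.addHaar_preimage_linearMap _ (by rwa [det_planeMap, Matrix.det_transpose]),
    det_planeMap, det_planeMap, Matrix.det_transpose, ENNReal.toReal_mul, ENNReal.toReal_mul,
    ENNReal.toReal_ofReal (abs_nonneg _), ENNReal.toReal_ofReal (abs_nonneg _), abs_inv]
  simp only [Measure.real]
  field_simp

theorem IsConvexBodyAroundOrigin.image_planeMap {M : Matrix (Fin 2) (Fin 2) ℝ} (hM : M.det ≠ 0)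
    {K : Set Plane} (hK : IsConvexBodyAroundOrigin K) :
    IsConvexBodyAroundOrigin (planeMap M '' K) where
  convex := hK.convex.linear_image _
  isCompact := hK.isCompact.image (planeMap M).continuous_of_finiteDimensional
  zero_mem_interior := by
    have hsurj : Function.Surjective (planeMap M) :=
      ((planeMap M).equivOfDetNeZero (by rwa [det_planeMap])).surjective
    have hopen : IsOpenMap (planeMap M) := (planeMap M).isOpenMap_of_finiteDimensional hsurj
    exact hopen.image_interior_subset K ⟨0, hK.zero_mem_interior, map_zero _⟩

/-- Any two positively oriented bases are related by an orientation preserving linear map. -/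
theorem exists_planeMap {a b a' b' : Plane} (h : 0 < cross a b) :
    ∃ M : Matrix (Fin 2) (Fin 2) ℝ, M.det * cross a b = cross a' b' ∧ planeMap M a = a' ∧
      planeMap M b = b' := by
  let M : Matrix (Fin 2) (Fin 2) ℝ :=
    !![(a' 0 * b 1 - b' 0 * a 1) / cross a b, (b' 0 * a 0 - a' 0 * b 0) / cross a b;
      (a' 1 * b 1 - b' 1 * a 1) / cross a b, (b' 1 * a 0 - a' 1 * b 0) / cross a b]
  have hne := h.ne'
  have e1 : planeMap M a = a' := by
    apply plane_ext <;> simp only [planeMap_apply, M, Matrix.of_apply, Matrix.cons_val] <;>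
      field_simp <;> simp only [cross] <;> ring
  have e2 : planeMap M b = b' := by
    apply plane_ext <;> simp only [planeMap_apply, M, Matrix.of_apply, Matrix.cons_val] <;>
      field_simp <;> simp only [cross] <;> ring
  exact ⟨M, by rw [← cross_planeMap, e1, e2], e1, e2⟩

/-! ### The Mahler–Reisner and Mahler–Meyer bounds. -/

theorem IsConvexBodyAroundOrigin.exists_cross_pos {K : Set Plane}
    (hK : IsConvexBodyAroundOrigin K) : ∃ a ∈ K, ∃ b ∈ K, 0 < cross a b := by
  obtain ⟨s, hs, ha⟩ := hK.exists_pos_smul_mem (dir 0)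
  obtain ⟨t, ht, hb⟩ := hK.exists_pos_smul_mem (dir (Real.pi / 2))
  refine ⟨_, ha, _, hb, ?_⟩
  rw [cross_smul_left, cross_smul_right, cross_dir_dir, sub_zero, Real.sin_pi_div_two]
  positivity

/-- Planar convex bodies symmetric about the origin have volume product at least `8`. -/
theorem eight_le_volumeProduct {K : Set Plane} (hK : IsConvexBodyAroundOrigin K)
    (hsymm : ∀ x ∈ K, -x ∈ K) : 8 ≤ volumeProduct K := by
  obtain ⟨a₀, ha₀, b₀, hb₀, hpos₀⟩ := hK.exists_cross_pos
  obtain ⟨⟨a, b⟩, ⟨ha, hb⟩, hmax⟩ := (hK.isCompact.prod hK.isCompact).exists_isMaxOn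
    ⟨(a₀, b₀), ha₀, hb₀⟩ (f := fun p : Plane × Plane => cross p.1 p.2)
    (by unfold cross; fun_prop)
  have hab : 0 < cross a b := hpos₀.trans_le (hmax (Set.mk_mem_prod ha₀ hb₀))
  obtain ⟨M, hdet, hMa, hMb⟩ := exists_planeMap (a' := ray 4 0 0) (b' := ray 4 0 1) hab
  have hcr : cross (ray 4 0 0) (ray 4 0 1) = 1 := by
    rw [cross_ray_ray_succ 4 0 0, ← Real.sin_pi_div_two]; congr 1; push_cast; ring
  rw [hcr] at hdet
  have hMpos : 0 < M.det := pos_of_mul_pos_left (by rw [hdet]; exact one_pos) hab.le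
  rw [← volumeProduct_image_planeMap hMpos.ne']
  have hK' := hK.image_planeMap hMpos.ne'
  have hmax' : ∀ X ∈ planeMap M '' K, ∀ Y ∈ planeMap M '' K, cross X Y ≤ 1 := by
    rintro _ ⟨x, hx, rfl⟩ _ ⟨y, hy, rfl⟩
    rw [cross_planeMap, ← hdet]
    exact mul_le_mul_of_nonneg_left (hmax (Set.mk_mem_prod hx hy)) hMpos.le
  have hopp : ∀ k, ray 4 0 (k + 2) = -ray 4 0 k := by
    intro k
    unfold ray
    rw [show (0 : ℝ) + 2 * Real.pi * ((k + 2 : ℕ) : ℝ) / (4 : ℕ) =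
      0 + 2 * Real.pi * k / (4 : ℕ) + Real.pi by push_cast; ring]
    apply plane_ext <;> simp [dir, Real.cos_add_pi, Real.sin_add_pi]
  have hmem : ∀ k, ray 4 0 k ∈ planeMap M '' K ∧ ray 4 0 (k + 1) ∈ planeMap M '' K := by
    intro k
    induction k with
    | zero => exact ⟨⟨a, ha, hMa⟩, ⟨b, hb, hMb⟩⟩
    | succ k ih =>
      refine ⟨ih.2, ?_⟩
      obtain ⟨x, hx, hxe⟩ := ih.1
      exact ⟨-x, hsymm x hx, by rw [map_neg, hxe, ← hopp]⟩
  -- By maximality of the determinant, the line through each of the points ±a', ±b' parallel to the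
  -- other axis supports the image. The outer square thus has the inner vertices as side midpoints,
  -- so δ = 0.
  have P : BetweenPolygons 4 0 1 1 0 0 (planeMap M '' K) :=
    { three_le := by norm_num
      body := hK'
      inradius_pos := one_pos
      circumradius_pos := one_pos
      neg_le := by have := Real.pi_pos; simp only [Left.neg_nonpos_iff]; positivity
      le := by positivity
      radii := by simp
      vertex_mem := fun k => by simpa using (hmem k).1
      inner_le := fun x hx k => by
        have h := hmax' x hx _ (hmem k).2
        have e : cross x (ray 4 0 (k + 1)) = inner ℝ x (ray 4 0 k) := by
          rw [ray_succ_eq, ray, show 2 * Real.pi / ((4 : ℕ) : ℝ) = Real.pi / 2 by push_cast; ring,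
            inner_plane]
          simp only [cross, dir, Matrix.cons_val, Real.sin_add_pi_div_two,
            Real.cos_add_pi_div_two]
          ring
        rw [sub_zero, ← e]; exact h }
  have h := P.volumeProduct_ge_and_eq.1
  rw [show Real.pi / ((4 : ℕ) : ℝ) = Real.pi / 4 by norm_num, Real.sin_pi_div_four, div_pow,
    Real.sq_sqrt (by norm_num)] at h
  norm_num at h
  exact h

/-- Planar convex bodies with the origin in the interior have volume product at least `27/4`. -/
theorem volumeProduct_ge_of_convexBody {K : Set Plane} (hK : IsConvexBodyAroundOrigin K) :
    27 / 4 ≤ volumeProduct K := by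
  obtain ⟨a₀, ha₀, b₀, hb₀, hpos₀⟩ := hK.exists_cross_pos
  obtain ⟨⟨x₀, x₁, x₂⟩, ⟨h0, h1, h2⟩, hmax⟩ :=
    (hK.isCompact.prod (hK.isCompact.prod hK.isCompact)).exists_isMaxOn
    ⟨(0, a₀, b₀), hK.zero_mem, ha₀, hb₀⟩
    (f := fun p : Plane × Plane × Plane => cross (p.2.1 - p.1) (p.2.2 - p.1))
    (by simp only [cross, PiLp.sub_apply]; fun_prop)
  have hmax0 : ∀ y₀ ∈ K, ∀ y₁ ∈ K, ∀ y₂ ∈ K,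
      cross (y₁ - y₀) (y₂ - y₀) ≤ cross (x₁ - x₀) (x₂ - x₀) := fun y₀ hy₀ y₁ hy₁ y₂ hy₂ =>
    hmax (Set.mk_mem_prod hy₀ (Set.mk_mem_prod hy₁ hy₂))
  have hx : 0 < cross (x₁ - x₀) (x₂ - x₀) := by
    refine hpos₀.trans_le ?_
    simpa using hmax0 0 hK.zero_mem a₀ ha₀ b₀ hb₀
  obtain ⟨M, hdet, hM1, hM2⟩ := exists_planeMap (a' := ray 3 0 1 - ray 3 0 0)
    (b' := ray 3 0 2 - ray 3 0 0) hx
  have hsin := sin_two_pi_div_pos (le_refl 3)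
  have hs := sin_pi_div_pos (le_refl 3)
  have hcr : cross (ray 3 0 1 - ray 3 0 0) (ray 3 0 2 - ray 3 0 0) =
      3 * Real.sin (2 * Real.pi / (3 : ℕ)) := by
    have e0 := cross_ray_ray_succ 3 0 0
    have e1 := cross_ray_ray_succ 3 0 1
    have e2 := cross_ray_ray_succ 3 0 2
    rw [show 2 + 1 = 0 + 3 by norm_num, ray_add_self le_rfl] at e2
    rw [cross_sub_left, cross_sub_right, cross_sub_right, cross_self_eq_zero,
      cross_swap (ray 3 0 1) (ray 3 0 0), cross_swap (ray 3 0 0) (ray 3 0 2), e2]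
    rw [zero_add] at e0
    rw [e0, show cross (ray 3 0 1) (ray 3 0 2) = _ from e1]
    ring
  rw [hcr] at hdet
  have hMpos : 0 < M.det := pos_of_mul_pos_left (by rw [hdet]; positivity) hx.le
  rw [← volumeProduct_image_planeMap hMpos.ne']
  have hK' := hK.image_planeMap hMpos.ne'
  have hmax' : ∀ X ∈ planeMap M '' K, ∀ Y ∈ planeMap M '' K, ∀ Z ∈ planeMap M '' K,
      cross (Y - X) (Z - X) ≤ 3 * Real.sin (2 * Real.pi / (3 : ℕ)) := by
    rintro _ ⟨x, hx, rfl⟩ _ ⟨y, hy, rfl⟩ _ ⟨w, hw, rfl⟩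
    rw [← map_sub, ← map_sub, cross_planeMap, ← hdet]
    exact mul_le_mul_of_nonneg_left (hmax0 x hx y hy w hw) hMpos.le
  -- The centre of the regularised triangle of largest area. It need not be the origin, so the bound
  -- is needed for an arbitrary `z`.
  set z := planeMap M x₀ - ray 3 0 0 with hz
  have hmem : ∀ k, z + ray 3 0 k ∈ planeMap M '' K := by
    intro k
    rw [← ray_mod le_rfl]
    have hlt : k % 3 < 3 := Nat.mod_lt _ (by norm_num)
    interval_cases k % 3
    · exact ⟨x₀, h0, by rw [hz]; abel⟩
    · refine ⟨x₁, h1, ?_⟩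
      rw [map_sub, sub_eq_iff_eq_add] at hM1
      rw [hM1, hz]; abel
    · refine ⟨x₂, h2, ?_⟩
      rw [map_sub, sub_eq_iff_eq_add] at hM2
      rw [hM2, hz]; abel
  have P : BetweenPolygons 3 z 1 1 0 0 (planeMap M '' K) :=
    { three_le := le_rfl
      body := hK'
      inradius_pos := one_pos
      circumradius_pos := one_pos
      neg_le := by have := Real.pi_pos; simp only [Left.neg_nonpos_iff]; positivity
      le := by positivity
      radii := by simp
      vertex_mem := fun k => by simpa using hmem k
      inner_le := fun x hx k => by
        have h := hmax' x hx _ (hmem (k + 1)) _ (hmem (k + 2))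
        have e1 := cross_ray_succ_sub (n := 3) 0 (k + 1) (x - z)
        -- The outer normal of the side opposite to the vertex `k` is minus the direction of that
        -- vertex. Maximality of the area says that the line through the vertex parallel to this
        -- side supports the body.
        have e2 : ray 3 (0 + Real.pi / (3 : ℕ)) (k + 1) = -ray 3 0 k := by
          unfold ray
          rw [show (0 : ℝ) + Real.pi / (3 : ℕ) + 2 * Real.pi * ((k + 1 : ℕ) : ℝ) / (3 : ℕ) =
            0 + 2 * Real.pi * k / (3 : ℕ) + Real.pi by push_cast; ring]
          apply plane_ext <;> simp [dir, Real.cos_add_pi, Real.sin_add_pi]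
        rw [e2, inner_neg_right] at e1
        have e3 : cross (z + ray 3 0 (k + 1) - x) (z + ray 3 0 (k + 2) - x) =
            cross (ray 3 0 (k + 1)) (ray 3 0 (k + 2)) -
              cross (x - z) (ray 3 0 (k + 1 + 1) - ray 3 0 (k + 1)) := by
          simp only [cross, PiLp.sub_apply, PiLp.add_apply]; ring
        rw [e3, e1, show k + 2 = (k + 1) + 1 by ring, cross_ray_ray_succ, sin_two_pi_div,
          show Real.pi / ((3 : ℕ) : ℝ) = Real.pi / 3 by norm_num, Real.cos_pi_div_three] at h
        rw [show Real.pi / ((3 : ℕ) : ℝ) = Real.pi / 3 by norm_num] at hs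
        refine le_of_mul_le_mul_left (a := 2 * Real.sin (Real.pi / 3)) ?_ (by positivity)
        linarith }
  have h := P.volumeProduct_ge_and_eq.1
  rw [show Real.pi / ((3 : ℕ) : ℝ) = Real.pi / 3 by norm_num, Real.sin_pi_div_three, div_pow,
    Real.sq_sqrt (by norm_num)] at h
  norm_num at h
  exact h

theorem theorem3 :
    (∀ (n : ℕ), 3 ≤ n →
      ∀ (zi zo : Plane) (ri ro θi θo : ℝ), 0 < ri → 0 < ro →
        (∀ j : ℕ, ∃ k : ℕ, regularVertex n zi ri θi j ∈ regularSide n zo ro θo k) →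
        (n = 3 → ∀ k : ℕ, ∃ j : ℕ, regularVertex n zi ri θi j ∈ regularSide n zo ro θo k) →
        zi = zo ∧
        ∀ K : Set Plane, IsConvexBodyAroundOrigin K →
          regularPolygon n zi ri θi ⊆ K → K ⊆ regularPolygon n zo ro θo →
          (n : ℝ) ^ 2 * Real.sin (Real.pi / n) ^ 2 ≤ volumeProduct K ∧
          (volumeProduct K = (n : ℝ) ^ 2 * Real.sin (Real.pi / n) ^ 2 ↔
            zo = 0 ∧ (K = regularPolygon n zi ri θi ∨ K = regularPolygon n zo ro θo))) ∧
    (∀ K : Set Plane, IsConvexBodyAroundOrigin K → (∀ x ∈ K, -x ∈ K) →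
      8 ≤ volumeProduct K) ∧
    (∀ K : Set Plane, IsConvexBodyAroundOrigin K →
      27 / 4 ≤ volumeProduct K) := by
  refine ⟨?_, fun K hK hsymm => eight_le_volumeProduct hK hsymm,
    fun K hK => volumeProduct_ge_of_convexBody hK⟩
  intro n hn zi zo ri ro θi θo hri hro hv hthree
  obtain ⟨rfl, δ, m, hδ1, hδ2, hrad, hθ⟩ :=
    concentric_of_vertices_mem_sides hn hri hro hv hthree
  exact ⟨rfl, fun K hK hi ho =>
    volumeProduct_between_regularPolygons hn hri hro hδ1 hδ2 hrad hθ hK hi ho⟩
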